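/- Let $\mathcal M$ be a finite-dimensional smooth Riemannian manifold (without boundary) with Riemannian distance $\mathrm{dist}$, metric $\langle\cdot,\cdot\rangle$ and norm $\|\cdot\|$ on the tangent spaces, and let $f:\mathcal M\to\mathbb R$ be twice continuously differentiable, with Riemannian gradient $\mathrm{grad} f$ and Riemannian Hessian $\mathrm{Hess} f(x)[v]=\nabla_v\,\mathrm{grad} f$ ($\nabla$ the Levi-Civita connection). Let $R:T\mathcal M\to\mathcal M$ be a retraction of class $C^2$: $R_x(0)=x$ and $\frac{d}{ds}R_x(sv)|_{s=0}=v$ for all $x\in\mathcal M$, $v\in T_x\mathcal M$. Put $\hat f_x=f\circ R_x:T_x\mathcal M\to\mathbb R$. Let $\chi_1>0$, $0<\chi_2<\tfrac12$, $\epsilon>0$, $0<\beta\le 1$, $0<t\le1$, and for each $x$ let $\mathscr P(x):T_x\mathcal M\to T_x\mathcal M$ be a self-adjoint positive definite linear operator. Let $x_k\in\mathcal M$, $\eta_k\in T_{x_k}\mathcal M$, $\alpha_k\in\mathbb R$ ($k\ge0$) be generated by the Riemannian truncated Newton method, with $\mathrm{grad} f(x_k)\neq0$ for all $k$; that is, for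 every $k$: (a) $\eta_k$ is the vector returned by the following truncated preconditioned conjugate gradient method with $g=\mathrm{grad} f(x_k)$, $H=\mathrm{Hess} f(x_k)$, $P=\mathscr P(x_k)$ and $\phi_k=\min\{\beta,\|\mathrm{grad} f(x_k)\|^t\}$. Start with $i=0$, $\eta^{(0)}=0$, $r^{(0)}=-g$, $d^{(0)}=y^{(0)}=P^{-1}r^{(0)}$, $\delta^{(0)}=\langle y^{(0)},y^{(0)}\rangle$. In pass $i$: if $\langle d^{(i)},Hd^{(i)}\rangle\le\epsilon\,\delta^{(i)}$, return $d^{(0)}$ if $i=0$ and $\eta^{(i)}$ otherwise. Else set $a=\langle r^{(i)},y^{(i)}\rangle/\langle d^{(i)},Hd^{(i)}\rangle$, $\eta^{(i+1)}=\eta^{(i)}+a\,d^{(i)}$, $r^{(i+1)}=r^{(i)}-a\,Hd^{(i)}$, $y^{(i+1)}=P^{-1}r^{(i+1)}$, $b=\langle r^{(i+1)},y^{(i+1)}\rangle/\langle r^{(i)},y^{(i)}\rangle$, $d^{(i+1)}=y^{(i+1)}+b\,d^{(i)}$, $\delta^{(i+1)}=\langle y^{(i+1)},y^{(i+1)}\rangle+b^2\delta^{(i)}$;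 if $\|r^{(i+1)}\|/\|g\|\le\phi_k$, return $\eta^{(i+1)}$; otherwise go to pass $i+1$. (b) $\alpha_k$ is acceptable at $k$, where $\alpha$ is called acceptable at $k$ if, with $h_k(s)=f(R_{x_k}(s\eta_k))$, at least one of $h_k(\alpha)-h_k(0)\le-\chi_1 h_k'(0)^2/\|\eta_k\|^2$ and $h_k(\alpha)-h_k(0)\le\chi_2h_k'(0)$ holds. (c) $x_{k+1}=R_{x_k}(\alpha_k\eta_k)$. Assume that there are constants $p_1>0$ and $p_2$ such that all eigenvalues of $\mathscr P(x)$ lie in $[p_1,p_2]$ for every $x$ with $f(x)\le f(x_0)$. Suppose that $x_k\to x^*$, that $\mathrm{Hess} f(x^*)$ is positive definite, and that the curvature tolerance is small relative to it: $\epsilon\,\frac{p_2}{p_1}\|v\|^2<\langle\mathrm{Hess} f(x^*)[v],v\rangle$ for all $0\ne v\in T_{x^*}\mathcal M$. Then: 1. The step size $1$ is acceptable at $k$ for all sufficiently large $k$. Suppose further that, for all sufficiently large $k$, the line search takes $\alpha_k=1$ whenever $1$ is acceptable at $k$. Then: 2. $\displaystyle\lim_{k\to\infty}\frac{\mathrm{dist}(x^*,x_{k+1})}{\mathrm{dist}(x^*,x_k)}=0$.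 3. If moreover there is $\beta_1>0$ with $\|\mathrm{Hess} f(x_k)-\mathrm{Hess}\hat f_{x_k}(0_{x_k})\|\le\beta_1\|\mathrm{grad} f(x_k)\|$ for all $k$, and there are $\beta_2,\mu_1,\mu_2>0$ with $\|\mathrm{Hess}\hat f_x(\xi)-\mathrm{Hess}\hat f_x(0_x)\|\le\beta_2\|\xi\|$ whenever $\mathrm{dist}(x,x^*)\le\mu_1$, $\xi\in T_x\mathcal M$ and $\|\xi\|\le\mu_2$ (operator norms), then $$\limsup_{k\to\infty}\frac{\mathrm{dist}(x^*,x_{k+1})}{\mathrm{dist}(x^*,x_k)^{1+\min(1,t)}}<\infty .$$ -/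

import Mathlib

open Set Filter Bundle Manifold
open scoped Topology ContDiff ENNReal

noncomputable section

namespace RTN

section Geometry

variable {E : Type*} [NormedAddCommGroup E] [NormedSpace ℝ E] [FiniteDimensional ℝ E]
  {M : Type*} [EMetricSpace M] [ChartedSpace E M] [IsManifold 𝓘(ℝ, E) ∞ M]
  [RiemannianBundle (fun x : M => TangentSpace 𝓘(ℝ, E) x)]

instance (x : M) : FiniteDimensional ℝ (TangentSpace 𝓘(ℝ, E) x) :=
  inferInstanceAs (FiniteDimensional ℝ E)

instance (x : M) : CompleteSpace (TangentSpace 𝓘(ℝ, E) x) :=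
  FiniteDimensional.complete ℝ _

variable (E) in
/-- The Riemannian gradient: the tangent vector `grad f x` with `⟪grad f x, v⟫ = df_x(v)`. -/
def grad (f : M → ℝ) (x : M) : TangentSpace 𝓘(ℝ, E) x :=
  (InnerProductSpace.toDual ℝ (TangentSpace 𝓘(ℝ, E) x)).symm (mvfderiv 𝓘(ℝ, E) f x)

/-- The right-hand side of the Koszul formula for `⟪∇_V Y, W⟫` at `x`,
for vector fields `V`, `Y`, `W`. -/
def koszul (V Y W : (x : M) → TangentSpace 𝓘(ℝ, E) x) (x : M) : ℝ :=
  (mvfderiv 𝓘(ℝ, E) (fun y => inner ℝ (Y y) (W y)) x (V x)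
    + mvfderiv 𝓘(ℝ, E) (fun y => inner ℝ (W y) (V y)) x (Y x)
    - mvfderiv 𝓘(ℝ, E) (fun y => inner ℝ (V y) (Y y)) x (W x)
    + inner ℝ (VectorField.mlieBracket 𝓘(ℝ, E) V Y x) (W x)
    - inner ℝ (VectorField.mlieBracket 𝓘(ℝ, E) V W x) (Y x)
    - inner ℝ (VectorField.mlieBracket 𝓘(ℝ, E) Y W x) (V x)) / 2

/-- The Levi-Civita covariant derivative `∇_v Y` at `x`: the vector whose inner product with each
`w` is given by the Koszul formula. The tangent vectors `v`, `w` are extended to vector fields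
near `x` (the formula does not depend on the extension), and the vector is written in an
orthonormal basis of the tangent space. -/
def leviCivita (Y : (x : M) → TangentSpace 𝓘(ℝ, E) x) (x : M) (v : TangentSpace 𝓘(ℝ, E) x) :
    TangentSpace 𝓘(ℝ, E) x :=
  let b := stdOrthonormalBasis ℝ (TangentSpace 𝓘(ℝ, E) x)
  ∑ i, koszul (FiberBundle.extend E v) Y (FiberBundle.extend E (b i)) x • b i

variable (E) in
/-- The Riemannian Hessian of `f` at `x`, acting on tangent vectors: `Hess f(x)[v] = ∇_v grad f`. -/
def hess (f : M → ℝ) (x : M) (v : TangentSpace 𝓘(ℝ, E) x) : TangentSpace 𝓘(ℝ, E) x :=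
  leviCivita (grad E f) x v

/-- A retraction, of class `C²` as a map from the tangent bundle to `M` (smooth retractions are
included): `R x 0 = x`, and the curve `s ↦ R x (s • v)` has velocity `v` at `s = 0`. -/
structure IsRetraction (R : (x : M) → TangentSpace 𝓘(ℝ, E) x → M) : Prop where
  contMDiff : ContMDiff 𝓘(ℝ, E).tangent 𝓘(ℝ, E) 2
    (fun p : TangentBundle 𝓘(ℝ, E) M => R p.1 p.2)
  map_zero : ∀ x, R x 0 = x
  velocity : ∀ (x : M) (v : TangentSpace 𝓘(ℝ, E) x),
    tangentMap 𝓘(ℝ, ℝ) 𝓘(ℝ, E) (fun s : ℝ => R x (s • v)) ⟨0, (1 : ℝ)⟩ = ⟨x, v⟩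

/-- The pullback of `f` to the tangent space at `x`. -/
def pullback (R : (x : M) → TangentSpace 𝓘(ℝ, E) x → M) (f : M → ℝ) (x : M) :
    TangentSpace 𝓘(ℝ, E) x → ℝ :=
  fun v => f (R x v)

/-- The Hessian of the pullback at a point of the Euclidean space `T_x M`: the derivative of its
gradient, both taken for the inner product of `T_x M`. -/
def hessPullback (R : (x : M) → TangentSpace 𝓘(ℝ, E) x → M) (f : M → ℝ) (x : M)
    (v : TangentSpace 𝓘(ℝ, E) x) : TangentSpace 𝓘(ℝ, E) x →L[ℝ] TangentSpace 𝓘(ℝ, E) x :=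
  fderiv ℝ (gradient (pullback R f x)) v

end Geometry

section ConjugateGradient

variable {V : Type*} [NormedAddCommGroup V] [InnerProductSpace ℝ V]

/-- The variables `η⁽ⁱ⁾, r⁽ⁱ⁾, y⁽ⁱ⁾, d⁽ⁱ⁾, δ⁽ⁱ⁾` of the preconditioned conjugate gradient loop. -/
structure CGState (V : Type*) where
  eta : V
  r : V
  y : V
  d : V
  delta : ℝ

/-- Initial values; `g` is the gradient and `Pinv` the inverse of the preconditioner. -/
def cgInit (g : V) (Pinv : V → V) : CGState V where
  eta := 0
  r := -g
  y := Pinv (-g)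
  d := Pinv (-g)
  delta := inner ℝ (Pinv (-g)) (Pinv (-g))

/-- One pass of the loop, from index `i` to index `i + 1`. -/
def cgStep (H Pinv : V → V) (s : CGState V) : CGState V :=
  let q := H s.d
  let a := inner ℝ s.r s.y / inner ℝ s.d q
  let r' := s.r - a • q
  let y' := Pinv r'
  let b := inner ℝ r' y' / inner ℝ s.r s.y
  { eta := s.eta + a • s.d
    r := r'
    y := y'
    d := y' + b • s.d
    delta := inner ℝ y' y' + b ^ 2 * s.delta }

/-- The loop variables with index `i`. -/
def cgIter (g : V) (H Pinv : V → V) (i : ℕ) : CGState V :=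
  (cgStep H Pinv)^[i] (cgInit g Pinv)

/-- The curvature test: `⟪d, H d⟫ ≤ ε δ`. -/
def NegCurv (H : V → V) (ε : ℝ) (s : CGState V) : Prop :=
  inner ℝ s.d (H s.d) ≤ ε * s.delta

/-- The residual test: `‖r‖ / ‖g‖ ≤ φ`. -/
def SmallResidual (g : V) (φ : ℝ) (s : CGState V) : Prop :=
  ‖s.r‖ / ‖g‖ ≤ φ

/-- `η` is the vector returned by the truncated preconditioned conjugate gradient method with
inputs `(g, H, P, ε, φ)`: no test succeeds in the passes `j < i`, and in pass `i` either the
curvature test succeeds (and `d⁽⁰⁾` is returned if `i = 0`, `η⁽ⁱ⁾` otherwise), or it fails, the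
residual test succeeds for index `i + 1`, and `η⁽ⁱ⁺¹⁾` is returned. -/
def IsTPCGOutput (g : V) (H : V → V) (P : V ≃ₗ[ℝ] V) (ε φ : ℝ) (η : V) : Prop :=
  ∃ i : ℕ,
    (∀ j < i, ¬ NegCurv H ε (cgIter g H P.symm j) ∧
      ¬ SmallResidual g φ (cgIter g H P.symm (j + 1))) ∧
    ((NegCurv H ε (cgIter g H P.symm i) ∧
        η = if i = 0 then (cgIter g H P.symm 0).d else (cgIter g H P.symm i).eta) ∨
      (¬ NegCurv H ε (cgIter g H P.symm i) ∧ SmallResidual g φ (cgIter g H P.symm (i + 1)) ∧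
        η = (cgIter g H P.symm (i + 1)).eta))

end ConjugateGradient

section Algorithm

variable {E : Type*} [NormedAddCommGroup E] [NormedSpace ℝ E] [FiniteDimensional ℝ E]
  {M : Type*} [EMetricSpace M] [ChartedSpace E M] [IsManifold 𝓘(ℝ, E) ∞ M]
  [RiemannianBundle (fun x : M => TangentSpace 𝓘(ℝ, E) x)]

/-- The step size `a` is acceptable at `x` in the direction `η`: with `h s = f (R_x (s η))`, at
least one of the two line search conditions holds. -/
def Acceptable (R : (x : M) → TangentSpace 𝓘(ℝ, E) x → M) (f : M → ℝ) (χ₁ χ₂ : ℝ) (x : M)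
    (η : TangentSpace 𝓘(ℝ, E) x) (a : ℝ) : Prop :=
  let h : ℝ → ℝ := fun s => f (R x (s • η))
  h a - h 0 ≤ -χ₁ * ((deriv h 0) ^ 2 / ‖η‖ ^ 2) ∨ h a - h 0 ≤ χ₂ * deriv h 0

/-- The preconditioner is self-adjoint and positive definite, and its eigenvalues lie in
`[p₁, p₂]` at all points of the level set of `f` through `x₀`. -/
structure IsPreconditioner (P : (x : M) → TangentSpace 𝓘(ℝ, E) x ≃ₗ[ℝ] TangentSpace 𝓘(ℝ, E) x)
    (f : M → ℝ) (x₀ : M) (p₁ p₂ : ℝ) : Prop where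
  symm : ∀ (x : M) (v w : TangentSpace 𝓘(ℝ, E) x), inner ℝ (P x v) w = inner ℝ v (P x w)
  pos : ∀ (x : M) (v : TangentSpace 𝓘(ℝ, E) x), v ≠ 0 → 0 < inner ℝ (P x v) v
  eigenvalue_mem : ∀ x : M, f x ≤ f x₀ → ∀ μ : ℝ,
    Module.End.HasEigenvalue (P x).toLinearMap μ → p₁ ≤ μ ∧ μ ≤ p₂

/-- The infinite sequences `x`, `η`, `α` of iterates, search directions and step sizes are
generated by the Riemannian truncated Newton method with forcing sequence `φ`. -/
structure IsTruncatedNewton (R : (x : M) → TangentSpace 𝓘(ℝ, E) x → M) (f : M → ℝ)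
    (P : (x : M) → TangentSpace 𝓘(ℝ, E) x ≃ₗ[ℝ] TangentSpace 𝓘(ℝ, E) x)
    (χ₁ χ₂ ε : ℝ) (φ : ℕ → ℝ)
    (x : ℕ → M) (η : (k : ℕ) → TangentSpace 𝓘(ℝ, E) (x k)) (α : ℕ → ℝ) : Prop where
  direction : ∀ k, IsTPCGOutput (grad E f (x k)) (hess E f (x k)) (P (x k)) ε (φ k) (η k)
  acceptable : ∀ k, Acceptable R f χ₁ χ₂ (x k) (η k) (α k)
  step : ∀ k, x (k + 1) = R (x k) (α k • η k)

end Algorithm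

end RTN

end

namespace RTN

/-! ### Preconditioned conjugate gradients: conjugacy, descent, stopping -/

section ConjugateGradientTheory

variable {V : Type*} [NormedAddCommGroup V] [InnerProductSpace ℝ V]

/-! Near the limit the method is an inexact Newton method; all quantities are measured against
`‖g‖`, where `g = grad f(x_k)`.

Conjugate gradients: the accumulated `δ` satisfies `p₁ δ ≤ ⟪P d, d⟫ ≤ p₂ ‖d‖²` (`cgIter_delta_le`),
so the curvature test cannot succeed once the curvature of `H` exceeds `ε p₂ / p₁`. The loop then
stops on the residual test, `‖H η + g‖ ≤ φ ‖g‖`. As the slope `⟪g, η⁽ⁱ⁾⟫` never increases, its value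
after one pass gives `⟪g, η⟫ ≤ -a ‖g‖²` (`IsTPCGOutput.residual_and_slope`). Coercivity of the
Hessian adds `‖η‖ ≤ b ‖g‖`.

The limit is not assumed to be critical. Each accepted step lowers `f` by a fixed multiple of `‖g‖²`
while `f(x_k)` converges, so `g → 0`; the limit is critical and the forcing terms `φ_k` tend to `0`.

The analytic core is `exists_fderiv_pullback_expansion`: the derivative of the pullback `f̂_y = f ∘
R_y` at `ξ` is `grad f(y) + Hess f(y)[ξ] + o(‖ξ‖)`, uniformly in `y` near the limit. No second-order
condition on `R` is needed: at a critical point both the second derivatives of `R` and the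
Christoffel terms are multiplied by the vanishing derivative of `f`.

Three consequences follow. First, `f̂(η) - f = ½ ⟪g, η⟫ + o(‖g‖²)`, and `χ₂ < ½` makes the unit step
acceptable. Second, the derivative of `f̂` at `η` is `o(‖g‖)`; it controls the distance of the next
iterate from the limit (`exists_edist_retraction_le`), and `‖g‖` is at most a multiple of the
current distance (`exists_norm_grad_le_edist`), so convergence is superlinear. Third, under the
Lipschitz hypotheses the `o(‖g‖)` becomes `O(‖g‖^(1+t))`. -/

theorem cgIter_succ (g : V) (H Pinv : V → V) (i : ℕ) :
    cgIter g H Pinv (i + 1) = cgStep H Pinv (cgIter g H Pinv i) :=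
  Function.iterate_succ_apply' _ _ _

theorem cgIter_y (g : V) (H Pinv : V → V) (i : ℕ) :
    (cgIter g H Pinv i).y = Pinv (cgIter g H Pinv i).r := by
  cases i with
  | zero => rfl
  | succ i => rw [cgIter_succ]; rfl

theorem cgIter_r (g : V) (H : V →ₗ[ℝ] V) (Pinv : V → V) (i : ℕ) :
    (cgIter g H Pinv i).r = -g - H (cgIter g H Pinv i).eta := by
  induction i with
  | zero => simp [cgIter, cgInit]
  | succ i ih =>
    rw [cgIter_succ]
    simp only [cgStep, map_add, map_smul, ih]
    abel

theorem cgIter_delta_nonneg (g : V) (H Pinv : V → V) (i : ℕ) :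
    0 ≤ (cgIter g H Pinv i).delta := by
  induction i with
  | zero => exact real_inner_self_nonneg
  | succ i ih =>
    rw [cgIter_succ]
    have := real_inner_self_nonneg (x := Pinv ((cgIter g H Pinv i).r -
      (inner ℝ (cgIter g H Pinv i).r (cgIter g H Pinv i).y /
        inner ℝ (cgIter g H Pinv i).d (H (cgIter g H Pinv i).d)) • H (cgIter g H Pinv i).d))
    simp only [cgStep]
    positivity

theorem symm_apply_inner (P : V ≃ₗ[ℝ] V) (hP : ∀ v w, inner ℝ (P v) w = inner ℝ v (P w))
    (v w : V) : inner ℝ (P.symm v) w = inner ℝ v (P.symm w) := by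
  have := hP (P.symm v) (P.symm w)
  simpa using this.symm

theorem inner_symm_pos (P : V ≃ₗ[ℝ] V) (hpos : ∀ v, v ≠ 0 → 0 < inner ℝ (P v) v) {v : V}
    (hv : v ≠ 0) : 0 < inner ℝ v (P.symm v) := by
  have := hpos (P.symm v) (by simpa using hv)
  simpa using this

variable {g : V} {H : V →ₗ[ℝ] V} {P : V ≃ₗ[ℝ] V} {n : ℕ}

/-- Orthogonality of the residuals to, and conjugacy of, the previous directions. -/
theorem cgIter_conjugate (hH : ∀ v w, inner ℝ (H v) w = inner ℝ v (H w))
    (hP : ∀ v w, inner ℝ (P v) w = inner ℝ v (P w))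
    (hpos : ∀ v, v ≠ 0 → 0 < inner ℝ (P v) v)
    (hcurv : ∀ j < n, 0 < inner ℝ (cgIter g H P.symm j).d (H (cgIter g H P.symm j).d))
    (hr : ∀ j < n, (cgIter g H P.symm j).r ≠ 0) :
    ∀ i ≤ n, (∀ l < i, inner ℝ (cgIter g H P.symm i).r (cgIter g H P.symm l).d = (0 : ℝ)) ∧
      (∀ l < i, inner ℝ (cgIter g H P.symm i).d (H (cgIter g H P.symm l).d) = (0 : ℝ)) ∧
      inner ℝ (cgIter g H P.symm i).r (cgIter g H P.symm i).d =
        (inner ℝ (cgIter g H P.symm i).r (cgIter g H P.symm i).y : ℝ) := by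
  set s := cgIter g H P.symm with hs
  have hy : ∀ j, (s j).y = P.symm (s j).r := fun j => cgIter_y g H P.symm j
  set a : ℕ → ℝ := fun j => inner ℝ (s j).r (s j).y / inner ℝ (s j).d (H (s j).d) with ha
  set b : ℕ → ℝ := fun j => inner ℝ (s (j + 1)).r (s (j + 1)).y / inner ℝ (s j).r (s j).y with hb
  have hr' : ∀ j, (s (j + 1)).r = (s j).r - a j • H (s j).d := fun j => by
    rw [hs, cgIter_succ]; rfl
  have hd' : ∀ j, (s (j + 1)).d = (s (j + 1)).y + b j • (s j).d := fun j => by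
    simp only [hb, hs, cgIter_succ]; rfl
  have hd0 : (s 0).d = (s 0).y := rfl
  have hrho : ∀ j < n, 0 < inner ℝ (s j).r (s j).y := fun j hj => by
    rw [hy]; exact inner_symm_pos P hpos (hr j hj)
  intro i
  induction i with
  | zero => intro _; simp [hd0]
  | succ i ih =>
    intro hi
    obtain ⟨hA, hC, hE⟩ := ih (by omega)
    have hcur := hcurv i (by omega)
    have hri := hrho i (by omega)
    -- For `l < i` this is inherited through conjugacy; for `l = i` it is the choice of the step
    -- length `a`.
    have hA' : ∀ l < i + 1, inner ℝ (s (i + 1)).r (s l).d = (0 : ℝ) := by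
      intro l hl
      rw [hr', inner_sub_left, inner_smul_left, hH]
      rcases Nat.lt_succ_iff_lt_or_eq.1 hl with h | rfl
      · rw [hA l h, hC l h]; simp
      · rw [hE]
        simp only [ha, RCLike.conj_to_real]
        field_simp
        ring
    -- Each `y` is a combination of the current and the preceding direction.
    have hB : ∀ l < i + 1, inner ℝ (s (i + 1)).r (s l).y = (0 : ℝ) := by
      intro l hl
      cases l with
      | zero => rw [← hd0]; exact hA' 0 hl
      | succ l =>
        have h1 := hA' (l + 1) hl
        rw [hd', inner_add_right, inner_smul_right, hA' l (by omega)] at h1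
        simpa using h1
    refine ⟨hA', ?_, ?_⟩
    · intro l hl
      have hal : 0 < a l := div_pos (hrho l (by omega)) (hcurv l (by omega))
      have hHd : a l • H (s l).d = (s l).r - (s (l + 1)).r := by rw [hr']; abel
      -- `a H d` is a difference of consecutive residuals, so moving `P⁻¹` across the inner product
      -- reduces conjugacy to `hB`. For `l = i` one term survives, and `b` is chosen to cancel it.
      have hyr : a l * inner ℝ (s (i + 1)).y (H (s l).d) =
          inner ℝ (s (i + 1)).r (s l).y - inner ℝ (s (i + 1)).r (s (l + 1)).y := by
        rw [← inner_smul_right, hHd, hy (i + 1), symm_apply_inner P hP, map_sub, inner_sub_right,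
          ← hy, ← hy]
      have hkey : a l * inner ℝ (s (i + 1)).d (H (s l).d) = 0 := by
        rw [hd', inner_add_left, inner_smul_left, mul_add, hyr, hB l hl]
        rcases Nat.lt_succ_iff_lt_or_eq.1 hl with h | rfl
        · rw [hB (l + 1) (by omega), hC l h]; simp
        · simp only [hb, ha, RCLike.conj_to_real]
          field_simp
          ring
      exact (mul_eq_zero.1 hkey).resolve_left hal.ne'
    · rw [hd', inner_add_right, inner_smul_right, hA' i (by omega)]; simp

/-- The number `⟪r⁽ᵐ⁾, d⁽ⁱ⁾⟫` does not depend on `m ≤ i`, because consecutive residuals differ by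
multiples of `H d⁽ᵐ⁾`, which is orthogonal to `d⁽ⁱ⁾`. Comparing `m = 0` with `m = i` gives the
identity. -/
theorem cgIter_inner_d (hH : ∀ v w, inner ℝ (H v) w = inner ℝ v (H w))
    (hP : ∀ v w, inner ℝ (P v) w = inner ℝ v (P w))
    (hpos : ∀ v, v ≠ 0 → 0 < inner ℝ (P v) v)
    (hcurv : ∀ j < n, 0 < inner ℝ (cgIter g H P.symm j).d (H (cgIter g H P.symm j).d))
    (hr : ∀ j < n, (cgIter g H P.symm j).r ≠ 0) (i : ℕ) (hi : i ≤ n) :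
    inner ℝ g (cgIter g H P.symm i).d =
      -(inner ℝ (cgIter g H P.symm i).r (cgIter g H P.symm i).y : ℝ) := by
  obtain ⟨-, hC, hE⟩ := cgIter_conjugate hH hP hpos hcurv hr i hi
  have key : ∀ m ≤ i, inner ℝ (cgIter g H P.symm m).r (cgIter g H P.symm i).d =
      (-inner ℝ g (cgIter g H P.symm i).d : ℝ) := by
    intro m
    induction m with
    | zero => intro _; simp [cgIter, cgInit]
    | succ m ih =>
      intro hm
      rw [← ih (by omega), cgIter_succ g H P.symm m]
      simp only [cgStep]
      rw [inner_sub_left, inner_smul_left, real_inner_comm, real_inner_comm _ (H _),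
        hC m (by omega)]
      simp
  have := key i le_rfl
  linarith

/-- Each pass with positive curvature decreases the slope `⟪g, η⟫`. -/
theorem cgIter_inner_eta_succ (hH : ∀ v w, inner ℝ (H v) w = inner ℝ v (H w))
    (hP : ∀ v w, inner ℝ (P v) w = inner ℝ v (P w))
    (hpos : ∀ v, v ≠ 0 → 0 < inner ℝ (P v) v)
    (hcurv : ∀ j < n, 0 < inner ℝ (cgIter g H P.symm j).d (H (cgIter g H P.symm j).d))
    (hr : ∀ j < n, (cgIter g H P.symm j).r ≠ 0) (i : ℕ) (hi : i ≤ n) :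
    inner ℝ g (cgIter g H P.symm (i + 1)).eta = inner ℝ g (cgIter g H P.symm i).eta -
      (inner ℝ (cgIter g H P.symm i).r (cgIter g H P.symm i).y : ℝ) ^ 2 /
        inner ℝ (cgIter g H P.symm i).d (H (cgIter g H P.symm i).d) := by
  rw [cgIter_succ]
  simp only [cgStep]
  rw [inner_add_right, inner_smul_right, cgIter_inner_d hH hP hpos hcurv hr i hi]
  ring

theorem cgIter_inner_eta_le (hH : ∀ v w, inner ℝ (H v) w = inner ℝ v (H w))
    (hP : ∀ v w, inner ℝ (P v) w = inner ℝ v (P w))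
    (hpos : ∀ v, v ≠ 0 → 0 < inner ℝ (P v) v)
    (hcurv : ∀ j < n, 0 < inner ℝ (cgIter g H P.symm j).d (H (cgIter g H P.symm j).d))
    (hr : ∀ j < n, (cgIter g H P.symm j).r ≠ 0) {i l : ℕ} (hli : l ≤ i) (hi : i ≤ n) :
    inner ℝ g (cgIter g H P.symm i).eta ≤ (inner ℝ g (cgIter g H P.symm l).eta : ℝ) := by
  induction i, hli using Nat.le_induction with
  | base => rfl
  | succ i hli ih =>
    rw [cgIter_inner_eta_succ hH hP hpos hcurv hr i (by omega)]
    have := hcurv i (by omega)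
    have h2 : 0 ≤ (inner ℝ (cgIter g H P.symm i).r (cgIter g H P.symm i).y : ℝ) ^ 2 /
        inner ℝ (cgIter g H P.symm i).d (H (cgIter g H P.symm i).d) := by positivity
    linarith [ih (by omega)]

theorem pos_curvature_of_not_negCurv {ε : ℝ} (hε : 0 ≤ ε) {i : ℕ}
    (h : ¬ NegCurv H ε (cgIter g H P.symm i)) :
    0 < inner ℝ (cgIter g H P.symm i).d (H (cgIter g H P.symm i).d) :=
  lt_of_le_of_lt (mul_nonneg hε (cgIter_delta_nonneg _ _ _ _)) (not_le.1 h)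

theorem cgIter_r_ne_zero {φ : ℝ} (hφ : 0 ≤ φ) (hg : g ≠ 0) {i : ℕ}
    (h : ∀ j < i, ¬ SmallResidual g φ (cgIter g H P.symm (j + 1))) :
    (cgIter g H P.symm i).r ≠ 0 := by
  cases i with
  | zero => simpa [cgIter, cgInit] using hg
  | succ i =>
    intro h0
    refine h i (by omega) ?_
    simpa [SmallResidual, h0] using hφ

/-- The truncated conjugate gradient method never returns an ascent direction. -/
theorem IsTPCGOutput.inner_nonpos {ε φ : ℝ} {η : V} (hη : IsTPCGOutput g H P ε φ η)
    (hH : ∀ v w, inner ℝ (H v) w = inner ℝ v (H w))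
    (hP : ∀ v w, inner ℝ (P v) w = inner ℝ v (P w))
    (hpos : ∀ v, v ≠ 0 → 0 < inner ℝ (P v) v) (hε : 0 ≤ ε) (hφ : 0 ≤ φ) (hg : g ≠ 0) :
    inner ℝ g η ≤ (0 : ℝ) := by
  obtain ⟨i, hprev, hi⟩ := hη
  have hr : ∀ j < i + 1, (cgIter g H P.symm j).r ≠ 0 := fun j hj =>
    cgIter_r_ne_zero hφ hg fun l hl => (hprev l (by omega)).2
  have hcurv : ∀ j < i, 0 < inner ℝ (cgIter g H P.symm j).d (H (cgIter g H P.symm j).d) :=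
    fun j hj => pos_curvature_of_not_negCurv hε (hprev j hj).1
  have h0 : inner ℝ g (cgIter g H P.symm 0).eta = (0 : ℝ) := by simp [cgIter, cgInit]
  rcases hi with ⟨-, rfl⟩ | ⟨hc, -, rfl⟩
  · split_ifs with h
    · have := inner_symm_pos P hpos hg
      simp only [cgIter, cgInit, Function.iterate_zero, id, map_neg, inner_neg_right]
      linarith
    · rw [← h0]
      exact cgIter_inner_eta_le hH hP hpos hcurv (fun j hj => hr j (by omega)) (by omega) le_rfl
  · rw [← h0]
    refine cgIter_inner_eta_le (n := i + 1) hH hP hpos (fun j hj => ?_) hr (by omega) le_rfl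
    rcases Nat.lt_succ_iff_lt_or_eq.1 hj with h | rfl
    · exact hcurv j h
    · exact pos_curvature_of_not_negCurv hε hc

/-- Since `⟪P y⁽ⁱ⁺¹⁾, d⁽ⁱ⁾⟫ = ⟪r⁽ⁱ⁺¹⁾, d⁽ⁱ⁾⟫ = 0`, the quantity `⟪P d, d⟫` obeys the recurrence of
`δ` with `⟪P y, y⟫` in place of `⟪y, y⟫`. The first bound lets `δ` be compared with `‖d‖²`; the
second shows that `d ≠ 0` while `y ≠ 0`. -/
theorem cgIter_delta_le (hH : ∀ v w, inner ℝ (H v) w = inner ℝ v (H w))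
    (hP : ∀ v w, inner ℝ (P v) w = inner ℝ v (P w))
    (hpos : ∀ v, v ≠ 0 → 0 < inner ℝ (P v) v) {p₁ : ℝ}
    (hp : ∀ v, p₁ * ‖v‖ ^ 2 ≤ inner ℝ (P v) v)
    (hcurv : ∀ j < n, 0 < inner ℝ (cgIter g H P.symm j).d (H (cgIter g H P.symm j).d))
    (hr : ∀ j < n, (cgIter g H P.symm j).r ≠ 0) (i : ℕ) (hi : i ≤ n) :
    p₁ * (cgIter g H P.symm i).delta ≤
      inner ℝ (P (cgIter g H P.symm i).d) (cgIter g H P.symm i).d ∧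
    inner ℝ (P (cgIter g H P.symm i).y) (cgIter g H P.symm i).y ≤
      (inner ℝ (P (cgIter g H P.symm i).d) (cgIter g H P.symm i).d : ℝ) := by
  induction i with
  | zero =>
    refine ⟨?_, le_rfl⟩
    have := hp (P.symm (-g))
    rw [← real_inner_self_eq_norm_sq] at this
    exact this
  | succ i ih =>
    obtain ⟨ih, -⟩ := ih (by omega)
    have hA := (cgIter_conjugate hH hP hpos hcurv hr (i + 1) hi).1 i (by omega)
    set s := cgIter g H P.symm with hs
    have hy : (s (i + 1)).y = P.symm (s (i + 1)).r := cgIter_y g H P.symm _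
    set b : ℝ := inner ℝ (s (i + 1)).r (s (i + 1)).y / inner ℝ (s i).r (s i).y with hb
    have hd : (s (i + 1)).d = (s (i + 1)).y + b • (s i).d := by
      simp only [hb, hs, cgIter_succ]; rfl
    have hδ : (s (i + 1)).delta =
        inner ℝ (s (i + 1)).y (s (i + 1)).y + b ^ 2 * (s i).delta := by
      simp only [hb, hs, cgIter_succ]; rfl
    have h1 : inner ℝ (P (s (i + 1)).y) (s i).d = (0 : ℝ) := by rw [hy]; simpa using hA
    have h2 : inner ℝ (P (s (i + 1)).d) (s (i + 1)).d =
        inner ℝ (P (s (i + 1)).y) (s (i + 1)).y + b ^ 2 * inner ℝ (P (s i).d) (s i).d := by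
      have h3 : inner ℝ (P (s i).d) (s (i + 1)).y = (0 : ℝ) := by
        rw [hP, real_inner_comm, h1]
      rw [hd]
      simp only [map_add, map_smul, inner_add_left, inner_add_right, inner_smul_left,
        inner_smul_right, h1, h3, RCLike.conj_to_real]
      ring
    have h4 : 0 ≤ inner ℝ (P (s i).d) (s i).d := by
      rcases eq_or_ne (s i).d 0 with h | h
      · simp [h]
      · exact (hpos _ h).le
    rw [h2, hδ, real_inner_self_eq_norm_sq]
    constructor
    · nlinarith [hp (s (i + 1)).y, mul_le_mul_of_nonneg_left ih (sq_nonneg b)]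
    · nlinarith [mul_nonneg (sq_nonneg b) h4]

/-- If the curvature of `H` dominates the tolerance, the truncated conjugate gradient method stops
with a small residual, and the returned direction has sufficient slope. -/
theorem IsTPCGOutput.residual_and_slope {ε φ : ℝ} {η : V} (hη : IsTPCGOutput g H P ε φ η)
    (hH : ∀ v w, inner ℝ (H v) w = inner ℝ v (H w))
    (hP : ∀ v w, inner ℝ (P v) w = inner ℝ v (P w))
    (hpos : ∀ v, v ≠ 0 → 0 < inner ℝ (P v) v) (hε : 0 ≤ ε) (hφ : 0 ≤ φ) (hg : g ≠ 0)
    {p₁ p₂ Λ : ℝ} (hp₁ : 0 < p₁) (hΛ : 0 < Λ)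
    (hp : ∀ v, p₁ * ‖v‖ ^ 2 ≤ inner ℝ (P v) v) (hp' : ∀ v, inner ℝ (P v) v ≤ p₂ * ‖v‖ ^ 2)
    (hp'' : ∀ v, ‖P v‖ ^ 2 ≤ p₂ * inner ℝ (P v) v)
    (hlow : ∀ v, v ≠ 0 → ε * (p₂ / p₁) * ‖v‖ ^ 2 < inner ℝ (H v) v)
    (hup : ∀ v, inner ℝ (H v) v ≤ Λ * ‖v‖ ^ 2) :
    ‖H η + g‖ ≤ φ * ‖g‖ ∧ inner ℝ g η ≤ -(p₁ / (p₂ * Λ)) * ‖g‖ ^ 2 := by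
  have hgn : 0 < ‖g‖ := norm_pos_iff.2 hg
  have hp₂ : 0 < p₂ := by
    have h1 := hp g
    have h2 := hp' g
    by_contra! h
    nlinarith [mul_pos hp₁ (pow_pos hgn 2), mul_nonneg (neg_nonneg.2 h) (pow_pos hgn 2).le]
  obtain ⟨i, hprev, hi⟩ := hη
  have hr : ∀ j < i + 1, (cgIter g H P.symm j).r ≠ 0 := fun j hj =>
    cgIter_r_ne_zero hφ hg fun l hl => (hprev l (by omega)).2
  have hcurv : ∀ j < i, 0 < inner ℝ (cgIter g H P.symm j).d (H (cgIter g H P.symm j).d) :=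
    fun j hj => pos_curvature_of_not_negCurv hε (hprev j hj).1
  -- The chain is `ε δ ≤ (ε / p₁) ⟪P d, d⟫ ≤ ε (p₂ / p₁) ‖d‖² < ⟪H d, d⟫`.
  have hnot : ¬ NegCurv H ε (cgIter g H P.symm i) := by
    obtain ⟨h1, h2⟩ := cgIter_delta_le hH hP hpos hp hcurv (fun j hj => hr j (by omega)) i le_rfl
    have hyne : (cgIter g H P.symm i).y ≠ 0 := by
      rw [cgIter_y]; simpa using hr i (by omega)
    have hdne : (cgIter g H P.symm i).d ≠ 0 := by
      intro h0
      rw [h0] at h2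
      simp only [map_zero, inner_zero_right] at h2
      exact absurd (hpos _ hyne) (not_lt.2 h2)
    rw [NegCurv, not_le, real_inner_comm]
    refine lt_of_le_of_lt ?_ (hlow _ hdne)
    rw [mul_assoc]
    refine mul_le_mul_of_nonneg_left ?_ hε
    rw [div_mul_eq_mul_div, le_div_iff₀ hp₁, mul_comm]
    exact h1.trans (hp' _)
  rcases hi with ⟨h, -⟩ | ⟨-, hsmall, rfl⟩
  · exact absurd h hnot
  have hcurv' : ∀ j < i + 1, 0 < inner ℝ (cgIter g H P.symm j).d (H (cgIter g H P.symm j).d) := by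
    intro j hj
    rcases Nat.lt_succ_iff_lt_or_eq.1 hj with h | rfl
    · exact hcurv j h
    · exact pos_curvature_of_not_negCurv hε hnot
  constructor
  · have h1 := (div_le_iff₀ hgn).1 hsmall
    rw [cgIter_r, ← norm_neg] at h1
    rwa [show H (cgIter g H P.symm (i + 1)).eta + g =
      -(-g - H (cgIter g H P.symm (i + 1)).eta) by abel]
  · have h0 : inner ℝ g (cgIter g H P.symm 0).eta = (0 : ℝ) := by simp [cgIter, cgInit]
    -- By monotonicity of the slope only the first pass has to be estimated; there `d = y = w =
    -- P⁻¹(-g)`.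
    refine (cgIter_inner_eta_le hH hP hpos hcurv' hr (l := 1) (by omega) le_rfl).trans ?_
    rw [cgIter_inner_eta_succ hH hP hpos hcurv' hr 0 (by omega), h0]
    have hc0 := hcurv' 0 (by omega)
    simp only [cgIter, cgInit, Function.iterate_zero, id] at hc0 ⊢
    set w := P.symm (-g) with hw
    have hPw : P w = -g := by simp [hw]
    have hwne : w ≠ 0 := by rw [hw]; simpa using hg
    have hwn : 0 < ‖w‖ := norm_pos_iff.2 hwne
    rw [← hPw]
    have e1 := hp w
    have e2 := hp'' w
    have e3 := hup w
    rw [hPw, norm_neg] at e2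
    rw [hPw] at e1 ⊢
    have e4 : 0 < inner ℝ (-g) w := lt_of_lt_of_le (by positivity) e1
    rw [real_inner_comm] at e3
    -- One factor `⟪-g, w⟫` is at least `‖g‖² / p₂`, the other at least `p₁ ‖w‖²`; the denominator
    -- is at most `Λ ‖w‖²`.
    have e5 : p₁ / (p₂ * Λ) * ‖g‖ ^ 2 ≤ (inner ℝ (-g) w) ^ 2 / inner ℝ w (H w) := by
      rw [div_mul_eq_mul_div, div_le_div_iff₀ (by positivity) hc0]
      calc p₁ * ‖g‖ ^ 2 * inner ℝ w (H w)
          ≤ p₁ * (p₂ * inner ℝ (-g) w) * (Λ * ‖w‖ ^ 2) := by gcongr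
        _ = (p₁ * ‖w‖ ^ 2) * (inner ℝ (-g) w * (p₂ * Λ)) := by ring
        _ ≤ inner ℝ (-g) w * (inner ℝ (-g) w * (p₂ * Λ)) := by gcongr
        _ = _ := by ring
    linarith

/-- Bounds on the quadratic form of a self-adjoint operator from bounds on its eigenvalues. -/
theorem inner_bounds_of_eigenvalue_mem [FiniteDimensional ℝ V] (P : V →ₗ[ℝ] V)
    (hP : ∀ v w, inner ℝ (P v) w = inner ℝ v (P w)) {p₁ p₂ : ℝ} (hp₁ : 0 < p₁)
    (h : ∀ μ : ℝ, Module.End.HasEigenvalue P μ → p₁ ≤ μ ∧ μ ≤ p₂) (v : V) :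
    p₁ * ‖v‖ ^ 2 ≤ inner ℝ (P v) v ∧ inner ℝ (P v) v ≤ p₂ * ‖v‖ ^ 2 ∧
      ‖P v‖ ^ 2 ≤ p₂ * inner ℝ (P v) v := by
  have hS : P.IsSymmetric := hP
  set b := hS.eigenvectorBasis (rfl : Module.finrank ℝ V = _) with hb
  set μ := hS.eigenvalues (rfl : Module.finrank ℝ V = _) with hμ
  have hμm : ∀ i, p₁ ≤ μ i ∧ μ i ≤ p₂ := fun i => h _ (by
    simpa using hS.hasEigenvalue_eigenvalues rfl i)
  have hPb : ∀ i, inner ℝ (b i) (P v) = μ i * inner ℝ (b i) v := fun i => by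
    rw [← hP, hS.apply_eigenvectorBasis rfl i, inner_smul_left]; simp [hμ, hb]
  have e1 : ‖v‖ ^ 2 = ∑ i, (inner ℝ (b i) v) ^ 2 := by
    rw [← b.sum_sq_norm_inner_right v]; simp
  have e2 : inner ℝ (P v) v = ∑ i, μ i * (inner ℝ (b i) v) ^ 2 := by
    rw [← b.sum_inner_mul_inner]
    refine Finset.sum_congr rfl fun i _ => ?_
    rw [real_inner_comm, hPb]; ring
  have e3 : ‖P v‖ ^ 2 = ∑ i, μ i ^ 2 * (inner ℝ (b i) v) ^ 2 := by
    rw [← b.sum_sq_norm_inner_right (P v)]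
    refine Finset.sum_congr rfl fun i _ => ?_
    rw [hPb]; simp [mul_pow]
  rw [e1, e2, e3, Finset.mul_sum, Finset.mul_sum, Finset.mul_sum]
  refine ⟨Finset.sum_le_sum fun i _ => ?_, Finset.sum_le_sum fun i _ => ?_,
    Finset.sum_le_sum fun i _ => ?_⟩
  · exact mul_le_mul_of_nonneg_right (hμm i).1 (sq_nonneg _)
  · exact mul_le_mul_of_nonneg_right (hμm i).2 (sq_nonneg _)
  · nlinarith [mul_nonneg (mul_nonneg (hp₁.le.trans (hμm i).1) (sub_nonneg.2 (hμm i).2))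
      (sq_nonneg (inner ℝ (b i) v : ℝ))]

end ConjugateGradientTheory

end RTN

noncomputable section

namespace RTN

/-! ### Normed structures on spaces of linear and multilinear maps -/

section Shortcuts

variable {E : Type*} [NormedAddCommGroup E] [NormedSpace ℝ E]

instance : NormedAddCommGroup (E →L[ℝ] ℝ) := ContinuousLinearMap.toNormedAddCommGroup

instance : NormedSpace ℝ (E →L[ℝ] ℝ) := ContinuousLinearMap.toNormedSpace

instance : NormedAddCommGroup (E →L[ℝ] E) := ContinuousLinearMap.toNormedAddCommGroup

instance : NormedSpace ℝ (E →L[ℝ] E) := ContinuousLinearMap.toNormedSpace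

instance : NormedAddCommGroup (E →L[ℝ] E →L[ℝ] ℝ) := ContinuousLinearMap.toNormedAddCommGroup

instance : NormedSpace ℝ (E →L[ℝ] E →L[ℝ] ℝ) := ContinuousLinearMap.toNormedSpace

instance : AddCommGroup (E →L[ℝ] E →L[ℝ] ℝ) := NormedAddCommGroup.toAddCommGroup

instance : Module ℝ (E →L[ℝ] E →L[ℝ] ℝ) := NormedSpace.toModule

instance : TopologicalSpace (E →L[ℝ] E →L[ℝ] ℝ) := ContinuousLinearMap.topologicalSpace

instance : IsTopologicalAddGroup (E →L[ℝ] E →L[ℝ] ℝ) := ContinuousLinearMap.topologicalAddGroup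

instance : TopologicalSpace (E →L[ℝ] E →L[ℝ] E →L[ℝ] ℝ) := ContinuousLinearMap.topologicalSpace

instance : NormedAddCommGroup (E →L[ℝ] E →L[ℝ] E →L[ℝ] ℝ) :=
  ContinuousLinearMap.toNormedAddCommGroup

instance : NormedSpace ℝ (E →L[ℝ] E →L[ℝ] E →L[ℝ] ℝ) := ContinuousLinearMap.toNormedSpace

end Shortcuts

/-! ### Calculus in a vector space: coordinate Hessian and fibrewise expansions -/

section Calculus

variable {E : Type*} [NormedAddCommGroup E] [NormedSpace ℝ E]

/-- A continuous family of bilinear forms that is positive definite at a point is uniformly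
coercive near this point. -/
theorem eventually_coercive [FiniteDimensional ℝ E] {X : Type*} [TopologicalSpace X]
    {A : X → E →L[ℝ] E →L[ℝ] ℝ} {x₀ : X}
    (hA : ContinuousAt A x₀) (hpos : ∀ a, a ≠ 0 → 0 < A x₀ a a) :
    ∃ m > 0, ∀ᶠ x in 𝓝 x₀, ∀ a, m * ‖a‖ ^ 2 ≤ A x a a := by
  obtain ⟨m, hm, hmA⟩ : ∃ m > 0, ∀ a, m * ‖a‖ ^ 2 ≤ A x₀ a a := by
    rcases subsingleton_or_nontrivial E with hE | hE
    · exact ⟨1, one_pos, fun a => by simp [Subsingleton.elim a 0]⟩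
    have hcomp : IsCompact (Metric.sphere (0 : E) 1) := isCompact_sphere 0 1
    have hne : (Metric.sphere (0 : E) 1).Nonempty := NormedSpace.sphere_nonempty.2 zero_le_one
    obtain ⟨b, hb, hmin⟩ := hcomp.exists_isMinOn hne
      (f := fun a => A x₀ a a) (by fun_prop)
    have hbne : b ≠ 0 := by
      rintro rfl
      simp at hb
    refine ⟨A x₀ b b, hpos b hbne, fun a => ?_⟩
    rcases eq_or_ne a 0 with rfl | ha
    · simp
    have han : 0 < ‖a‖ := norm_pos_iff.2 ha
    have h1 := isMinOn_iff.1 hmin (‖a‖⁻¹ • a) (by simp [norm_smul, han.ne'])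
    simp only [map_smul, smul_apply, smul_eq_mul] at h1
    calc A x₀ b b * ‖a‖ ^ 2 ≤ (‖a‖⁻¹ * (‖a‖⁻¹ * A x₀ a a)) * ‖a‖ ^ 2 := by gcongr
      _ = A x₀ a a := by field_simp
  -- Half of the constant at `x₀`, a minimum over the unit sphere, is left for the perturbation of
  -- `A`.
  refine ⟨m / 2, half_pos hm, ?_⟩
  have h1 : ∀ᶠ x in 𝓝 x₀, ‖A x - A x₀‖ < m / 2 :=
    (tendsto_iff_norm_sub_tendsto_zero.1 hA).eventually (gt_mem_nhds (half_pos hm))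
  filter_upwards [h1] with x hx a
  have h2 := (A x - A x₀).le_opNorm₂ a a
  simp only [sub_apply, Real.norm_eq_abs] at h2
  have h3 := neg_abs_le (A x a a - A x₀ a a)
  have h4 := hmA a
  nlinarith [mul_le_mul_of_nonneg_right hx.le (sq_nonneg ‖a‖)]

/-- A positive definite bilinear form on a finite-dimensional space, as an isomorphism onto the
dual space. -/
theorem exists_equiv_of_pos [FiniteDimensional ℝ E] {B : E →L[ℝ] E →L[ℝ] ℝ} (hB : ∀ a, a ≠ 0 → 0 < B a a) :
    ∃ e : E ≃L[ℝ] (E →L[ℝ] ℝ), (e : E →L[ℝ] E →L[ℝ] ℝ) = B := by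
  have hinj : Function.Injective (B : E →ₗ[ℝ] E →L[ℝ] ℝ) := by
    refine (injective_iff_map_eq_zero _).2 fun a ha => ?_
    by_contra h
    have := hB a h
    have h0 : B a = 0 := ha
    simp [h0] at this
  have hdim : Module.finrank ℝ E = Module.finrank ℝ (E →L[ℝ] ℝ) := by
    rw [← (LinearMap.toContinuousLinearMap (𝕜 := ℝ) (E := E) (F' := ℝ)).finrank_eq]
    exact (Subspace.dual_finrank_eq).symm
  refine ⟨(LinearEquiv.ofInjectiveOfFinrankEq (B : E →ₗ[ℝ] E →L[ℝ] ℝ) hinj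
    hdim).toContinuousLinearEquiv, ?_⟩
  rfl

/-- The gradient in coordinates, for a function `F` and a Gram matrix `G`. -/
def coordGrad (G : E → E →L[ℝ] E →L[ℝ] ℝ) (F : E → ℝ) (u : E) : E :=
  (G u).inverse (fderiv ℝ F u)

/-- The Hessian in coordinates, for a function `F` and a Gram matrix `G`. -/
def coordHess (G : E → E →L[ℝ] E →L[ℝ] ℝ) (F : E → ℝ) (u : E) : E →L[ℝ] E →L[ℝ] ℝ :=
  fderiv ℝ (fderiv ℝ F) u + (2⁻¹ : ℝ) • (fderiv ℝ G u (coordGrad G F u)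
    - (fderiv ℝ G u).flip (coordGrad G F u) - ((fderiv ℝ G u).flip (coordGrad G F u)).flip)

variable {G : E → E →L[ℝ] E →L[ℝ] ℝ} {F : E → ℝ} {u : E}

theorem coordHess_apply (a b : E) : coordHess G F u a b = fderiv ℝ (fderiv ℝ F) u a b +
    2⁻¹ * (fderiv ℝ G u (coordGrad G F u) a b - fderiv ℝ G u a (coordGrad G F u) b
      - fderiv ℝ G u b (coordGrad G F u) a) := by
  simp [coordHess]

theorem gram_coordGrad [FiniteDimensional ℝ E] (hpos : ∀ a, a ≠ 0 → 0 < G u a a) :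
    G u (coordGrad G F u) = fderiv ℝ F u := by
  obtain ⟨e, he⟩ := exists_equiv_of_pos hpos
  rw [coordGrad, ← he, ContinuousLinearMap.inverse_equiv]
  simp

theorem contDiffAt_coordGrad [FiniteDimensional ℝ E] (hpos : ∀ a, a ≠ 0 → 0 < G u a a)
    (hG : ContDiffAt ℝ 1 G u) (hF : ContDiffAt ℝ 2 F u) : ContDiffAt ℝ 1 (coordGrad G F) u := by
  obtain ⟨e, he⟩ := exists_equiv_of_pos hpos
  have h1 : ContDiffAt ℝ 1 ContinuousLinearMap.inverse (G u) := by
    rw [← he]; exact contDiffAt_map_inverse e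
  have h2 : ContDiffAt ℝ 1 (fun u => (G u).inverse) u := h1.comp u hG
  exact h2.clm_apply (hF.fderiv_right (m := 1) (by norm_num))

theorem continuousAt_coordHess [FiniteDimensional ℝ E] (hpos : ∀ a, a ≠ 0 → 0 < G u a a)
    (hG : ContDiffAt ℝ 1 G u) (hF : ContDiffAt ℝ 2 F u) : ContinuousAt (coordHess G F) u := by
  have hY : ContinuousAt (coordGrad G F) u := (contDiffAt_coordGrad hpos hG hF).continuousAt
  have hD : ContinuousAt (fderiv ℝ G) u := (hG.fderiv_right (m := 0) (by norm_num)).continuousAt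
  have hF2 : ContinuousAt (fderiv ℝ (fderiv ℝ F)) u :=
    ((hF.fderiv_right (m := 1) (by norm_num)).fderiv_right (m := 0) (by norm_num)).continuousAt
  have hflip : ContinuousAt (fun u => (fderiv ℝ G u).flip) u :=
    (ContinuousLinearMap.flipₗᵢ ℝ E E (E →L[ℝ] ℝ)).continuous.continuousAt.comp hD
  have h1 : ContinuousAt (fun u => (fderiv ℝ G u).flip (coordGrad G F u)) u := hflip.clm_apply hY
  have h2 : ContinuousAt (fun u => ((fderiv ℝ G u).flip (coordGrad G F u)).flip) u :=
    (ContinuousLinearMap.flipₗᵢ ℝ E E ℝ).continuous.continuousAt.comp h1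
  exact hF2.add ((((hD.clm_apply hY).sub h1).sub h2).const_smul (2⁻¹ : ℝ))

theorem fderiv_bilinear_symm (hG : DifferentiableAt ℝ G u)
    (hsymm : ∀ᶠ w in 𝓝 u, ∀ a b, G w a b = G w b a) (z a b : E) :
    fderiv ℝ G u z a b = fderiv ℝ G u z b a := by
  have key : ∀ a b z : E, fderiv ℝ G u z a b = fderiv ℝ (fun w => G w a b) u z := by
    intro a b z
    have h3 : HasFDerivAt (fun w => G w a b) _ u := ((ContinuousLinearMap.apply ℝ ℝ b ∘L
      ContinuousLinearMap.apply ℝ (E →L[ℝ] ℝ) a).hasFDerivAt).comp u hG.hasFDerivAt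
    rw [h3.fderiv]
    rfl
  rw [key, key]
  exact congrArg (fun L : E →L[ℝ] ℝ => L z) (Filter.EventuallyEq.fderiv_eq
    (hsymm.mono fun w hw => hw a b))

theorem coordHess_symm (hF : ContDiffAt ℝ 2 F u) (hG : DifferentiableAt ℝ G u)
    (hsymm : ∀ᶠ w in 𝓝 u, ∀ a b, G w a b = G w b a) (a b : E) :
    coordHess G F u a b = coordHess G F u b a := by
  have h1 : fderiv ℝ (fderiv ℝ F) u a b = fderiv ℝ (fderiv ℝ F) u b a :=
    (hF.isSymmSndFDerivAt (by simp)).eq a b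
  rw [coordHess_apply, coordHess_apply, h1, fderiv_bilinear_symm hG hsymm _ a b]
  ring

/-- The Christoffel terms are linear in the gradient, so at a critical point the metric drops out.
-/
theorem coordHess_of_fderiv_eq_zero (h : fderiv ℝ F u = 0) :
    coordHess G F u = fderiv ℝ (fderiv ℝ F) u := by
  have : coordGrad G F u = 0 := by simp [coordGrad, h]
  simp [coordHess, this]

/-- The partial derivative in the second variable. -/
def partialSnd (Φ : E × E → ℝ) (p : E × E) : E →L[ℝ] ℝ :=
  fderiv ℝ Φ p ∘L ContinuousLinearMap.inr ℝ E E

variable {Rh : E × E → E}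

theorem partialSnd_comp {p : E × E} (hF : DifferentiableAt ℝ F (Rh p))
    (hR : DifferentiableAt ℝ Rh p) : partialSnd (F ∘ Rh) p =
      fderiv ℝ F (Rh p) ∘L (fderiv ℝ Rh p ∘L ContinuousLinearMap.inr ℝ E E) := by
  rw [partialSnd, fderiv_comp p hF hR, ContinuousLinearMap.comp_assoc]

/-- At a critical point `u` of `F`, the partial derivative of `F ∘ R` expands to first order along
the fibers, uniformly in the base point. -/
theorem partialSnd_comp_expansion (hF : ContDiffAt ℝ 2 F u) (hcrit : fderiv ℝ F u = 0)
    (hR : ContDiffAt ℝ 2 Rh (u, 0)) (hR0 : Rh (u, 0) = u)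
    (hR1 : fderiv ℝ Rh (u, 0) ∘L ContinuousLinearMap.inr ℝ E E = ContinuousLinearMap.id ℝ E)
    {δ : ℝ} (hδ : 0 < δ) :
    ∀ᶠ p in 𝓝 ((u, 0) : E × E), ‖partialSnd (F ∘ Rh) p - partialSnd (F ∘ Rh) (p.1, 0)
      - fderiv ℝ (fderiv ℝ F) u p.2‖ ≤ δ * ‖p.2‖ := by
  have hF' : ContDiffAt ℝ 2 F (Rh (u, 0)) := by rwa [hR0]
  have hC : ContDiffAt ℝ 1 (partialSnd (F ∘ Rh)) (u, 0) :=
    ((hF'.comp _ hR).fderiv_right (m := 1) (by norm_num)).clm_comp contDiffAt_const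
  have hS := hC.hasStrictFDerivAt (by norm_num)
  set L := fderiv ℝ (partialSnd (F ∘ Rh)) (u, 0) with hL
  -- In the product rule, the term with the second derivative of `Rh` is composed with `fderiv ℝ F u
  -- = 0`; in the other one both fibre derivatives of `Rh` are the identity.
  have hLa : ∀ a, L (0, a) = fderiv ℝ (fderiv ℝ F) u a := by
    intro a
    have e1 : partialSnd (F ∘ Rh) =ᶠ[𝓝 (u, 0)] fun p => fderiv ℝ F (Rh p) ∘L
        (fderiv ℝ Rh p ∘L ContinuousLinearMap.inr ℝ E E) := by
      have h1 := hR.eventually (by norm_num)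
      have h2 := hR.continuousAt.eventually (hF'.eventually (by norm_num))
      filter_upwards [h1, h2] with p hp1 hp2
      exact partialSnd_comp (hp2.differentiableAt (by norm_num)) (hp1.differentiableAt (by norm_num))
    have d1 : HasFDerivAt (fderiv ℝ F) (fderiv ℝ (fderiv ℝ F) u) (Rh (u, 0)) := by
      rw [hR0]
      exact ((hF.fderiv_right (m := 1) (by norm_num)).differentiableAt (by norm_num)).hasFDerivAt
    have d2 := d1.comp (u, (0 : E)) (hR.differentiableAt (by norm_num)).hasFDerivAt
    have d3 : DifferentiableAt ℝ (fun p => fderiv ℝ Rh p ∘L ContinuousLinearMap.inr ℝ E E)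
        (u, (0 : E)) :=
      (((hR.fderiv_right (m := 1) (by norm_num)).clm_comp
        contDiffAt_const).differentiableAt (by norm_num))
    have d4 := d2.clm_comp d3.hasFDerivAt
    rw [hL, e1.fderiv_eq]
    have d5 := d4.fderiv
    simp only [Function.comp_def] at d5
    rw [d5]
    have hRa : fderiv ℝ Rh (u, 0) (0, a) = a := congrArg (fun T => T a) hR1
    ext b
    have hRb : fderiv ℝ Rh (u, 0) (0, b) = b := congrArg (fun T => T b) hR1
    simp [hR0, hcrit, hRa, hRb]
  -- Strict differentiability compares two moving points; taking `p` and `(p.1, 0)` makes the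
  -- estimate uniform in the base point `p.1`.
  have ht : Tendsto (fun p : E × E => (p, ((p.1, 0) : E × E))) (𝓝 (u, 0))
      (𝓝 (((u, 0), (u, 0)) : (E × E) × (E × E))) := by
    have : Continuous fun p : E × E => (p, ((p.1, 0) : E × E)) := by fun_prop
    exact this.tendsto' _ _ rfl
  have h1 := (hS.isLittleO.comp_tendsto ht).bound hδ
  filter_upwards [h1] with p hp
  have e2 : p - (p.1, (0 : E)) = (0, p.2) := by ext <;> simp
  have hp' : ‖partialSnd (F ∘ Rh) p - partialSnd (F ∘ Rh) (p.1, 0) - L (p - (p.1, 0))‖ ≤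
      δ * ‖p - (p.1, 0)‖ := hp
  rw [e2, hLa] at hp'
  simpa using hp'

/-- The fibre derivative `A` of `Rh` is within `1/2` of the identity near `(u, 0)`, so composing
with it can lose at most a factor `2`. -/
theorem norm_fderiv_le_partialSnd (hF : ContDiffAt ℝ 2 F u)
    (hR : ContDiffAt ℝ 2 Rh (u, 0)) (hR0 : Rh (u, 0) = u)
    (hR1 : fderiv ℝ Rh (u, 0) ∘L ContinuousLinearMap.inr ℝ E E = ContinuousLinearMap.id ℝ E) :
    ∀ᶠ p in 𝓝 ((u, 0) : E × E), ‖fderiv ℝ F (Rh p)‖ ≤ 2 * ‖partialSnd (F ∘ Rh) p‖ := by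
  have hF' : ContDiffAt ℝ 2 F (Rh (u, 0)) := by rwa [hR0]
  have h1 := hR.eventually (by norm_num)
  have h2 := hR.continuousAt.eventually (hF'.eventually (by norm_num))
  have h3 : ContinuousAt (fun p => fderiv ℝ Rh p ∘L ContinuousLinearMap.inr ℝ E E) (u, 0) :=
    ((hR.fderiv_right (m := 1) (by norm_num)).clm_comp contDiffAt_const).continuousAt
  have h4 : ∀ᶠ p in 𝓝 ((u, 0) : E × E), ‖fderiv ℝ Rh p ∘L ContinuousLinearMap.inr ℝ E E -
      ContinuousLinearMap.id ℝ E‖ < 1 / 2 := by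
    have := tendsto_iff_norm_sub_tendsto_zero.1 h3
    simp only [hR1] at this
    exact this.eventually (gt_mem_nhds (by norm_num))
  filter_upwards [h1, h2, h4] with p hp1 hp2 hp4
  rw [partialSnd_comp (hp2.differentiableAt (by norm_num)) (hp1.differentiableAt (by norm_num))]
  set A := fderiv ℝ Rh p ∘L ContinuousLinearMap.inr ℝ E E
  set D := fderiv ℝ F (Rh p)
  have e : D = D ∘L A - D ∘L (A - ContinuousLinearMap.id ℝ E) := by ext; simp
  have e1 : ‖D‖ ≤ ‖D ∘L A‖ + ‖D‖ * ‖A - ContinuousLinearMap.id ℝ E‖ := by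
    conv_lhs => rw [e]
    exact (norm_sub_le _ _).trans (by gcongr; exact ContinuousLinearMap.opNorm_comp_le _ _)
  nlinarith [mul_le_mul_of_nonneg_left hp4.le (norm_nonneg D)]

/-- Near a nondegenerate critical point, the size of the derivative is comparable to the
distance. -/
theorem norm_fderiv_comparable [FiniteDimensional ℝ E] (hF : ContDiffAt ℝ 2 F u) (hcrit : fderiv ℝ F u = 0)
    (hpos : ∀ a, a ≠ 0 → 0 < fderiv ℝ (fderiv ℝ F) u a a) :
    ∃ c > 0, ∃ C > 0, ∀ᶠ w in 𝓝 u,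
      c * ‖w - u‖ ≤ ‖fderiv ℝ F w‖ ∧ ‖fderiv ℝ F w‖ ≤ C * ‖w - u‖ := by
  set B := fderiv ℝ (fderiv ℝ F) u with hB
  have hd : HasFDerivAt (fderiv ℝ F) B u :=
    ((hF.fderiv_right (m := 1) (by norm_num)).differentiableAt (by norm_num)).hasFDerivAt
  obtain ⟨m, hm, h⟩ := eventually_coercive (A := fun _ : E => B) (x₀ := u) continuousAt_const hpos
  have hm' : ∀ a, m * ‖a‖ ≤ ‖B a‖ := by
    intro a
    rcases eq_or_ne a 0 with rfl | ha
    · simp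
    have h1 := h.self_of_nhds a
    have h2 := (le_abs_self _).trans ((B a).le_opNorm a)
    have h3 : 0 < ‖a‖ := norm_pos_iff.2 ha
    refine le_of_mul_le_mul_right ?_ h3
    nlinarith
  refine ⟨m / 2, half_pos hm, ‖B‖ + m / 2, by positivity, ?_⟩
  filter_upwards [hd.isLittleO.bound (half_pos hm)] with w hw
  rw [hcrit, sub_zero] at hw
  have h1 := hm' (w - u)
  have h2 := B.le_opNorm (w - u)
  have h3 := norm_sub_norm_le (fderiv ℝ F w) (B (w - u))
  have h4 := norm_sub_norm_le (B (w - u)) (fderiv ℝ F w)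
  rw [norm_sub_rev] at h4
  constructor <;> linarith

end Calculus

/-! ### Tangent vectors, vector fields and Lie brackets in a chart -/

section Coordinates

variable {E : Type*} [NormedAddCommGroup E] [NormedSpace ℝ E]
  {M : Type*} [TopologicalSpace M] [ChartedSpace E M] {c x : M}

theorem mem_source_of_mem_target {u : E} (hu : u ∈ (extChartAt 𝓘(ℝ, E) c).target) :
    (extChartAt 𝓘(ℝ, E) c).symm u ∈ (chartAt E c).source := by
  rw [← extChartAt_source 𝓘(ℝ, E)]
  exact (extChartAt 𝓘(ℝ, E) c).map_target hu

theorem mem_target_of_mem_source (hx : x ∈ (chartAt E c).source) :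
    extChartAt 𝓘(ℝ, E) c x ∈ (extChartAt 𝓘(ℝ, E) c).target := by
  rw [← extChartAt_source 𝓘(ℝ, E)] at hx
  exact (extChartAt 𝓘(ℝ, E) c).map_source hx

theorem extChartAt_symm_apply (hx : x ∈ (chartAt E c).source) :
    (extChartAt 𝓘(ℝ, E) c).symm (extChartAt 𝓘(ℝ, E) c x) = x := by
  rw [← extChartAt_source 𝓘(ℝ, E)] at hx
  exact (extChartAt 𝓘(ℝ, E) c).left_inv hx

variable [IsManifold 𝓘(ℝ, E) ∞ M]

/-- A tangent vector at `x`, read in the chart at `c`. -/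
def toCoord (c x : M) : TangentSpace 𝓘(ℝ, E) x →L[ℝ] E :=
  (trivializationAt E (TangentSpace 𝓘(ℝ, E)) c).continuousLinearMapAt ℝ x

/-- The tangent vector at `x` with given coordinates in the chart at `c`. -/
def ofCoord (c x : M) : E →L[ℝ] TangentSpace 𝓘(ℝ, E) x :=
  (trivializationAt E (TangentSpace 𝓘(ℝ, E)) c).symmL ℝ x

theorem toCoord_ofCoord (hx : x ∈ (chartAt E c).source) (a : E) :
    toCoord c x (ofCoord c x a) = a :=
  (trivializationAt E (TangentSpace 𝓘(ℝ, E)) c).continuousLinearMapAt_symmL hx a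

theorem ofCoord_toCoord (hx : x ∈ (chartAt E c).source) (v : TangentSpace 𝓘(ℝ, E) x) :
    ofCoord c x (toCoord c x v) = v :=
  (trivializationAt E (TangentSpace 𝓘(ℝ, E)) c).symmL_continuousLinearMapAt hx v

theorem toCoord_eq_mfderiv (hx : x ∈ (chartAt E c).source) :
    toCoord c x = mfderiv 𝓘(ℝ, E) 𝓘(ℝ, E) (extChartAt 𝓘(ℝ, E) c) x :=
  TangentBundle.continuousLinearMapAt_trivializationAt hx

theorem contMDiffAt_extChartAt_symm {u : E} (hu : u ∈ (extChartAt 𝓘(ℝ, E) c).target) :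
    ContMDiffAt 𝓘(ℝ, E) 𝓘(ℝ, E) ∞ (extChartAt 𝓘(ℝ, E) c).symm u :=
  (contMDiffOn_extChartAt_symm c).contMDiffAt ((isOpen_extChartAt_target c).mem_nhds hu)

theorem toCoord_apply (hx : x ∈ (chartAt E c).source) (v : TangentSpace 𝓘(ℝ, E) x) :
    toCoord c x v = (trivializationAt E (TangentSpace 𝓘(ℝ, E)) c ⟨x, v⟩).2 :=
  (trivializationAt E (TangentSpace 𝓘(ℝ, E)) c).continuousLinearMapAt_apply_of_mem ℝ hx v

theorem inverse_toCoord (hx : x ∈ (chartAt E c).source) (v : TangentSpace 𝓘(ℝ, E) x) :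
    (toCoord c x).inverse (toCoord c x v) = v := by
  have h : ((trivializationAt E (TangentSpace 𝓘(ℝ, E)) c).continuousLinearEquivAt ℝ x hx :
      TangentSpace 𝓘(ℝ, E) x →L[ℝ] E) = toCoord c x :=
    (trivializationAt E (TangentSpace 𝓘(ℝ, E)) c).coe_continuousLinearEquivAt_eq' hx
  rw [← h, ContinuousLinearMap.inverse_equiv]
  exact ContinuousLinearEquiv.symm_apply_apply _ v

/-- The derivative of a function, read in the chart at `c`. -/
theorem mvfderiv_eq_fderiv {h : M → ℝ} (hx : x ∈ (chartAt E c).source)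
    (hh : DifferentiableAt ℝ (h ∘ (extChartAt 𝓘(ℝ, E) c).symm) (extChartAt 𝓘(ℝ, E) c x))
    (v : TangentSpace 𝓘(ℝ, E) x) :
    mvfderiv 𝓘(ℝ, E) h x v = fderiv ℝ (h ∘ (extChartAt 𝓘(ℝ, E) c).symm)
      (extChartAt 𝓘(ℝ, E) c x) (toCoord c x v) := by
  have h1 := mfderiv_comp x hh.mdifferentiableAt (mdifferentiableAt_extChartAt
    (I := 𝓘(ℝ, E)) hx)
  rw [mfderiv_eq_fderiv] at h1
  have h2 : (h ∘ (extChartAt 𝓘(ℝ, E) c).symm) ∘ extChartAt 𝓘(ℝ, E) c =ᶠ[𝓝 x] h := by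
    filter_upwards [(chartAt E c).open_source.mem_nhds hx] with y hy
    simp only [Function.comp_apply, extChartAt_symm_apply hy]
  rw [h2.mfderiv_eq] at h1
  rw [toCoord_eq_mfderiv hx]
  exact congrArg (fun L : E →L[ℝ] ℝ => L v) h1

theorem contDiffAt_comp_extChartAt_symm {f : M → ℝ} (hf : ContMDiff 𝓘(ℝ, E) 𝓘(ℝ, ℝ) 2 f) {u : E}
    (hu : u ∈ (extChartAt 𝓘(ℝ, E) c).target) :
    ContDiffAt ℝ 2 (f ∘ (extChartAt 𝓘(ℝ, E) c).symm) u :=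
  (hf.contMDiffAt.comp u
    ((contMDiffAt_extChartAt_symm hu).of_le ENat.LEInfty.out)).contDiffAt

theorem mvfderiv_eq_fderiv_of_contMDiff {f : M → ℝ} (hf : ContMDiff 𝓘(ℝ, E) 𝓘(ℝ, ℝ) 2 f)
    (hx : x ∈ (chartAt E c).source) (v : TangentSpace 𝓘(ℝ, E) x) :
    mvfderiv 𝓘(ℝ, E) f x v = fderiv ℝ (f ∘ (extChartAt 𝓘(ℝ, E) c).symm)
      (extChartAt 𝓘(ℝ, E) c x) (toCoord c x v) :=
  mvfderiv_eq_fderiv hx ((contDiffAt_comp_extChartAt_symm hf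
    (mem_target_of_mem_source hx)).differentiableAt (by norm_num)) v

/-- A vector field, read in the chart at `c`. -/
def coordField (c : M) (V : (x : M) → TangentSpace 𝓘(ℝ, E) x) (u : E) : E :=
  toCoord c ((extChartAt 𝓘(ℝ, E) c).symm u) (V ((extChartAt 𝓘(ℝ, E) c).symm u))

theorem coordField_extChartAt (hx : x ∈ (chartAt E c).source)
    (V : (x : M) → TangentSpace 𝓘(ℝ, E) x) :
    coordField c V (extChartAt 𝓘(ℝ, E) c x) = toCoord c x (V x) := by
  rw [coordField, extChartAt_symm_apply hx]

theorem differentiableAt_coordField (hx : x ∈ (chartAt E c).source)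
    {V : (x : M) → TangentSpace 𝓘(ℝ, E) x}
    (hV : MDifferentiableAt 𝓘(ℝ, E) 𝓘(ℝ, E).tangent
      (fun y => (⟨y, V y⟩ : TangentBundle 𝓘(ℝ, E) M)) x) :
    DifferentiableAt ℝ (coordField c V) (extChartAt 𝓘(ℝ, E) c x) := by
  have h1 := ((trivializationAt E (TangentSpace 𝓘(ℝ, E)) c).mdifferentiableAt_section_iff
    𝓘(ℝ, E) V hx).1 hV
  have hs := (contMDiffAt_extChartAt_symm (mem_target_of_mem_source hx)).mdifferentiableAt
    (by simp)
  rw [← extChartAt_symm_apply hx] at h1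
  have h2 := (h1.comp (extChartAt 𝓘(ℝ, E) c x) hs).differentiableAt
  refine h2.congr_of_eventuallyEq ?_
  filter_upwards [(isOpen_extChartAt_target c).mem_nhds (mem_target_of_mem_source hx)] with u hu
  exact toCoord_apply (mem_source_of_mem_target hu) _

theorem mdifferentiableAt_of_differentiableAt {V : E → E} {u : E} (hV : DifferentiableAt ℝ V u) :
    MDifferentiableAt 𝓘(ℝ, E) 𝓘(ℝ, E).tangent
      (fun y => (⟨y, V y⟩ : TangentBundle 𝓘(ℝ, E) E)) u := by
  refine (mdifferentiableAt_section 𝓘(ℝ, E) (E := TangentSpace 𝓘(ℝ, E)) (F := E) V).2 ?_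
  refine hV.mdifferentiableAt.congr_of_eventuallyEq ?_
  filter_upwards with y
  rw [trivializationAt_model_space_apply]

theorem mlieBracket_vectorSpace (V W : E → E) (u : E) :
    VectorField.mlieBracket 𝓘(ℝ, E) (M := E) V W u = fderiv ℝ W u (V u) - fderiv ℝ V u (W u) := by
  have h := congrFun (VectorField.mlieBracketWithin_eq_lieBracketWithin (𝕜 := ℝ) (E := E)
    (V := V) (W := W) (s := univ)) u
  have h1 := congrFun (VectorField.mlieBracketWithin_univ (I := 𝓘(ℝ, E)) (V := V) (W := W)) u
  have h2 := congrFun (VectorField.lieBracketWithin_univ (𝕜 := ℝ) (V := V) (W := W)) u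
  exact h1.symm.trans (h.trans h2)

theorem mpullback_extChartAt (hx : x ∈ (chartAt E c).source) (Z : E → E) :
    VectorField.mpullback 𝓘(ℝ, E) 𝓘(ℝ, E) (extChartAt 𝓘(ℝ, E) c) Z x =
      (toCoord c x).inverse (Z (extChartAt 𝓘(ℝ, E) c x)) :=
  congrArg (fun L : TangentSpace 𝓘(ℝ, E) x →L[ℝ] E => L.inverse (Z (extChartAt 𝓘(ℝ, E) c x)))
    (toCoord_eq_mfderiv hx).symm

/-- The bracket is natural under pullback by the chart, and near `x` each field is the pullback of
its coordinate expression. -/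
theorem toCoord_mlieBracket [FiniteDimensional ℝ E] (hx : x ∈ (chartAt E c).source)
    {V W : (x : M) → TangentSpace 𝓘(ℝ, E) x}
    (hV : MDifferentiableAt 𝓘(ℝ, E) 𝓘(ℝ, E).tangent
      (fun y => (⟨y, V y⟩ : TangentBundle 𝓘(ℝ, E) M)) x)
    (hW : MDifferentiableAt 𝓘(ℝ, E) 𝓘(ℝ, E).tangent
      (fun y => (⟨y, W y⟩ : TangentBundle 𝓘(ℝ, E) M)) x) :
    toCoord c x (VectorField.mlieBracket 𝓘(ℝ, E) V W x) =
      fderiv ℝ (coordField c W) (extChartAt 𝓘(ℝ, E) c x) (toCoord c x (V x)) -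
      fderiv ℝ (coordField c V) (extChartAt 𝓘(ℝ, E) c x) (toCoord c x (W x)) := by
  have hpull : ∀ Z : (x : M) → TangentSpace 𝓘(ℝ, E) x,
      VectorField.mpullback 𝓘(ℝ, E) 𝓘(ℝ, E) (extChartAt 𝓘(ℝ, E) c) (coordField c Z)
        =ᶠ[𝓝 x] Z := by
    intro Z
    filter_upwards [(chartAt E c).open_source.mem_nhds hx] with y hy
    rw [mpullback_extChartAt hy, coordField_extChartAt hy, inverse_toCoord hy]
  have : IsManifold 𝓘(ℝ, E) (minSmoothness ℝ 2) M := by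
    rw [minSmoothness_of_isRCLikeNormedField]; infer_instance
  have key := VectorField.mpullback_mlieBracket (I := 𝓘(ℝ, E)) (I' := 𝓘(ℝ, E)) (n := 2)
    (f := extChartAt 𝓘(ℝ, E) c) (x₀ := x)
    (mdifferentiableAt_of_differentiableAt (differentiableAt_coordField hx hV))
    (mdifferentiableAt_of_differentiableAt (differentiableAt_coordField hx hW))
    (contMDiffAt_extChartAt' hx) (by simp)
  rw [(hpull V).mlieBracket_vectorField_eq (hpull W)] at key
  rw [← key]
  refine (congrArg (toCoord c x) (mpullback_extChartAt hx _)).trans ?_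
  have h1 : ∀ z : E, toCoord c x ((toCoord c x).inverse z) = z := fun z => by
    conv_lhs => rw [← toCoord_ofCoord hx z, inverse_toCoord hx]
    exact toCoord_ofCoord hx z
  refine (h1 _).trans ((mlieBracket_vectorSpace _ _ _).trans ?_)
  rw [coordField_extChartAt hx, coordField_extChartAt hx]

end Coordinates

/-! ### The metric in a chart -/

section Metric

variable {E : Type*} [NormedAddCommGroup E] [NormedSpace ℝ E]
  {M : Type*} [TopologicalSpace M] [ChartedSpace E M] [IsManifold 𝓘(ℝ, E) ∞ M]
  [RiemannianBundle (fun x : M => TangentSpace 𝓘(ℝ, E) x)]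

/-- The metric, read in the chart at `c`. -/
def gram (c : M) (u : E) : E →L[ℝ] E →L[ℝ] ℝ :=
  (innerSL ℝ (E := TangentSpace 𝓘(ℝ, E) ((extChartAt 𝓘(ℝ, E) c).symm u))).bilinearComp
    (ofCoord c ((extChartAt 𝓘(ℝ, E) c).symm u)) (ofCoord c ((extChartAt 𝓘(ℝ, E) c).symm u))

variable {c x : M}

theorem gram_apply (u a b : E) : gram c u a b =
    inner ℝ (ofCoord c ((extChartAt 𝓘(ℝ, E) c).symm u) a)
      (ofCoord c ((extChartAt 𝓘(ℝ, E) c).symm u) b) := rfl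

theorem gram_toCoord (hx : x ∈ (chartAt E c).source) (v w : TangentSpace 𝓘(ℝ, E) x) :
    gram c (extChartAt 𝓘(ℝ, E) c x) (toCoord c x v) (toCoord c x w) = inner ℝ v w := by
  rw [gram_apply, extChartAt_symm_apply hx, ofCoord_toCoord hx, ofCoord_toCoord hx]

theorem gram_pos {u : E} (hu : u ∈ (extChartAt 𝓘(ℝ, E) c).target) (a : E) (ha : a ≠ 0) :
    0 < gram c u a a := by
  rw [gram_apply, real_inner_self_pos]
  intro h
  have := toCoord_ofCoord (mem_source_of_mem_target hu) a
  rw [h, map_zero] at this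
  exact ha this.symm

theorem gram_symm (u a b : E) : gram c u a b = gram c u b a := by
  rw [gram_apply, gram_apply, real_inner_comm]

theorem contDiffAt_gram [FiniteDimensional ℝ E]
    [IsContMDiffRiemannianBundle 𝓘(ℝ, E) ∞ E (fun x : M => TangentSpace 𝓘(ℝ, E) x)]
    {u : E} (hu : u ∈ (extChartAt 𝓘(ℝ, E) c).target) : ContDiffAt ℝ ∞ (gram c) u := by
  have hopen := isOpen_extChartAt_target (I := 𝓘(ℝ, E)) c
  refine ContDiffOn.contDiffAt ?_ (hopen.mem_nhds hu)
  rw [contDiffOn_clm_apply]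
  intro a
  rw [contDiffOn_clm_apply]
  intro b w hw
  have hsec : ∀ a : E, ContMDiffAt 𝓘(ℝ, E) 𝓘(ℝ, E).tangent ∞
      (fun u => (⟨(extChartAt 𝓘(ℝ, E) c).symm u, ofCoord c ((extChartAt 𝓘(ℝ, E) c).symm u) a⟩ :
        TangentBundle 𝓘(ℝ, E) M)) w := by
    intro a
    refine ((trivializationAt E (TangentSpace 𝓘(ℝ, E)) c).contMDiffAt_iff
      (f := fun u => (⟨(extChartAt 𝓘(ℝ, E) c).symm u,
        ofCoord c ((extChartAt 𝓘(ℝ, E) c).symm u) a⟩ : TangentBundle 𝓘(ℝ, E) M))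
      ((Trivialization.coe_mem_source _).2 (mem_source_of_mem_target hw))).2 ⟨contMDiffAt_extChartAt_symm hw, ?_⟩
    refine (contMDiffAt_const (c := a)).congr_of_eventuallyEq ?_
    filter_upwards [hopen.mem_nhds hw] with z hz
    rw [← toCoord_apply (mem_source_of_mem_target hz), toCoord_ofCoord (mem_source_of_mem_target hz)]
  have hin : ContMDiffAt 𝓘(ℝ, E) 𝓘(ℝ, ℝ) ∞ (fun u =>
      inner ℝ (ofCoord c ((extChartAt 𝓘(ℝ, E) c).symm u) a)
        (ofCoord c ((extChartAt 𝓘(ℝ, E) c).symm u) b)) w :=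
    ContMDiffAt.inner_bundle (IB := 𝓘(ℝ, E)) (F := E) (E := fun x : M => TangentSpace 𝓘(ℝ, E) x)
      (b := (extChartAt 𝓘(ℝ, E) c).symm) (hsec a) (hsec b)
  exact hin.contDiffAt.contDiffWithinAt

end Metric

/-! ### Riemannian gradient and Hessian in a chart -/

section Hessian

variable {E : Type*} [NormedAddCommGroup E] [NormedSpace ℝ E] [FiniteDimensional ℝ E]
  {M : Type*} [EMetricSpace M] [ChartedSpace E M]
  [RiemannianBundle (fun x : M => TangentSpace 𝓘(ℝ, E) x)]
  {c x : M} {f : M → ℝ}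

theorem inner_grad (f : M → ℝ) (x : M) (v : TangentSpace 𝓘(ℝ, E) x) :
    inner ℝ (grad E f x) v = mvfderiv 𝓘(ℝ, E) f x v :=
  InnerProductSpace.toDual_symm_apply

variable [IsManifold 𝓘(ℝ, E) ∞ M]

theorem toCoord_grad (hf : ContMDiff 𝓘(ℝ, E) 𝓘(ℝ, ℝ) 2 f) (hx : x ∈ (chartAt E c).source) :
    toCoord c x (grad E f x) =
      coordGrad (gram c) (f ∘ (extChartAt 𝓘(ℝ, E) c).symm) (extChartAt 𝓘(ℝ, E) c x) := by
  obtain ⟨e, he⟩ := exists_equiv_of_pos (gram_pos (mem_target_of_mem_source hx))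
  have h1 : e (toCoord c x (grad E f x)) =
      fderiv ℝ (f ∘ (extChartAt 𝓘(ℝ, E) c).symm) (extChartAt 𝓘(ℝ, E) c x) := by
    ext a
    have h2 : e (toCoord c x (grad E f x)) a =
        gram c (extChartAt 𝓘(ℝ, E) c x) (toCoord c x (grad E f x)) a := by rw [← he]; rfl
    rw [h2, ← toCoord_ofCoord hx a, gram_toCoord hx, inner_grad,
      mvfderiv_eq_fderiv_of_contMDiff hf hx]
  rw [coordGrad, ← he, ContinuousLinearMap.inverse_equiv, ← h1]
  exact (e.symm_apply_apply _).symm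

variable [IsContMDiffRiemannianBundle 𝓘(ℝ, E) ∞ E (fun x : M => TangentSpace 𝓘(ℝ, E) x)]

theorem contDiffAt_gram_one {u : E} (hu : u ∈ (extChartAt 𝓘(ℝ, E) c).target) :
    ContDiffAt ℝ 1 (gram c) u :=
  (contDiffAt_gram hu).of_le ENat.LEInfty.out

theorem mdifferentiableAt_grad (hf : ContMDiff 𝓘(ℝ, E) 𝓘(ℝ, ℝ) 2 f) (x : M) :
    MDifferentiableAt 𝓘(ℝ, E) 𝓘(ℝ, E).tangent
      (fun y => (⟨y, grad E f y⟩ : TangentBundle 𝓘(ℝ, E) M)) x := by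
  have hx := mem_chart_source E x
  refine ((trivializationAt E (TangentSpace 𝓘(ℝ, E)) x).mdifferentiableAt_section_iff
    𝓘(ℝ, E) (grad E f) hx).2 ?_
  have h1 : DifferentiableAt ℝ (coordGrad (gram x) (f ∘ (extChartAt 𝓘(ℝ, E) x).symm))
      (extChartAt 𝓘(ℝ, E) x x) :=
    (contDiffAt_coordGrad (gram_pos (mem_target_of_mem_source hx))
      (contDiffAt_gram_one (mem_target_of_mem_source hx))
      (contDiffAt_comp_extChartAt_symm hf (mem_target_of_mem_source hx))).differentiableAt
      (by norm_num)
  refine (h1.mdifferentiableAt.comp x (mdifferentiableAt_extChartAt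
    (I := 𝓘(ℝ, E)) hx)).congr_of_eventuallyEq ?_
  filter_upwards [(chartAt E x).open_source.mem_nhds hx] with y hy
  rw [← toCoord_apply hy, toCoord_grad hf hy]
  rfl

/-- The product rule for the inner product of two vector fields, in the chart at `c`. -/
theorem mvfderiv_inner (hx : x ∈ (chartAt E c).source) {V W : (x : M) → TangentSpace 𝓘(ℝ, E) x}
    (hV : MDifferentiableAt 𝓘(ℝ, E) 𝓘(ℝ, E).tangent
      (fun y => (⟨y, V y⟩ : TangentBundle 𝓘(ℝ, E) M)) x)
    (hW : MDifferentiableAt 𝓘(ℝ, E) 𝓘(ℝ, E).tangent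
      (fun y => (⟨y, W y⟩ : TangentBundle 𝓘(ℝ, E) M)) x) (z : TangentSpace 𝓘(ℝ, E) x) :
    mvfderiv 𝓘(ℝ, E) (fun y => (inner ℝ (V y) (W y) : ℝ)) x z =
      fderiv ℝ (gram c) (extChartAt 𝓘(ℝ, E) c x) (toCoord c x z) (toCoord c x (V x))
        (toCoord c x (W x)) +
      gram c (extChartAt 𝓘(ℝ, E) c x)
        (fderiv ℝ (coordField c V) (extChartAt 𝓘(ℝ, E) c x) (toCoord c x z)) (toCoord c x (W x)) +
      gram c (extChartAt 𝓘(ℝ, E) c x) (toCoord c x (V x))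
        (fderiv ℝ (coordField c W) (extChartAt 𝓘(ℝ, E) c x) (toCoord c x z)) := by
  have hu := mem_target_of_mem_source hx
  have hG : HasFDerivAt (gram c) _ (extChartAt 𝓘(ℝ, E) c x) :=
    ((contDiffAt_gram_one hu).differentiableAt (by norm_num)).hasFDerivAt
  have h1 := (hG.clm_apply (differentiableAt_coordField hx hV).hasFDerivAt).clm_apply
    (differentiableAt_coordField hx hW).hasFDerivAt
  have h2 : (fun u => gram c u (coordField c V u) (coordField c W u))
      =ᶠ[𝓝 (extChartAt 𝓘(ℝ, E) c x)]
        (fun y => (inner ℝ (V y) (W y) : ℝ)) ∘ (extChartAt 𝓘(ℝ, E) c).symm := by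
    filter_upwards [(isOpen_extChartAt_target c).mem_nhds hu] with u hu
    have := gram_toCoord (mem_source_of_mem_target hu) (V ((extChartAt 𝓘(ℝ, E) c).symm u))
      (W ((extChartAt 𝓘(ℝ, E) c).symm u))
    rwa [(extChartAt 𝓘(ℝ, E) c).right_inv hu] at this
  have h3 := h1.congr_of_eventuallyEq h2.symm
  rw [mvfderiv_eq_fderiv hx h3.differentiableAt, h3.fderiv]
  simp only [coordField_extChartAt hx, add_apply, ContinuousLinearMap.comp_apply,
    ContinuousLinearMap.flip_apply]
  ring

/-- For the gradient field, the Koszul formula reads as `coordHess` in the chart at `c`. -/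
theorem koszul_grad (hf : ContMDiff 𝓘(ℝ, E) 𝓘(ℝ, ℝ) 2 f) (hx : x ∈ (chartAt E c).source)
    {V W : (x : M) → TangentSpace 𝓘(ℝ, E) x}
    (hV : MDifferentiableAt 𝓘(ℝ, E) 𝓘(ℝ, E).tangent
      (fun y => (⟨y, V y⟩ : TangentBundle 𝓘(ℝ, E) M)) x)
    (hW : MDifferentiableAt 𝓘(ℝ, E) 𝓘(ℝ, E).tangent
      (fun y => (⟨y, W y⟩ : TangentBundle 𝓘(ℝ, E) M)) x) :
    koszul V (grad E f) W x = coordHess (gram c) (f ∘ (extChartAt 𝓘(ℝ, E) c).symm)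
      (extChartAt 𝓘(ℝ, E) c x) (toCoord c x (V x)) (toCoord c x (W x)) := by
  have hY := mdifferentiableAt_grad hf x
  have hu := mem_target_of_mem_source hx
  have hopen := (isOpen_extChartAt_target (I := 𝓘(ℝ, E)) c).mem_nhds hu
  have hG : DifferentiableAt ℝ (gram c) (extChartAt 𝓘(ℝ, E) c x) :=
    (contDiffAt_gram_one hu).differentiableAt (by norm_num)
  have hsymm := fderiv_bilinear_symm hG (Eventually.of_forall fun w a b => gram_symm w a b)
  have hF := contDiffAt_comp_extChartAt_symm hf hu
  -- This is the derivative of the identity `G Y = DF`, where `Y` is the coordinate gradient and `G`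
  -- the Gram matrix.
  have hD2 : ∀ z b : E, fderiv ℝ (fderiv ℝ (f ∘ (extChartAt 𝓘(ℝ, E) c).symm))
      (extChartAt 𝓘(ℝ, E) c x) z b =
      fderiv ℝ (gram c) (extChartAt 𝓘(ℝ, E) c x) z (toCoord c x (grad E f x)) b +
      gram c (extChartAt 𝓘(ℝ, E) c x)
        (fderiv ℝ (coordField c (grad E f)) (extChartAt 𝓘(ℝ, E) c x) z) b := by
    intro z b
    have h1 := hG.hasFDerivAt.clm_apply (differentiableAt_coordField hx hY).hasFDerivAt
    have h2 : (fun u => gram c u (coordField c (grad E f) u)) =ᶠ[𝓝 (extChartAt 𝓘(ℝ, E) c x)]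
        fderiv ℝ (f ∘ (extChartAt 𝓘(ℝ, E) c).symm) := by
      filter_upwards [hopen] with u hu
      rw [coordField, toCoord_grad hf (mem_source_of_mem_target hu),
        (extChartAt 𝓘(ℝ, E) c).right_inv hu, gram_coordGrad (gram_pos hu)]
    rw [(h1.congr_of_eventuallyEq h2.symm).fderiv]
    simp only [coordField_extChartAt hx, add_apply, ContinuousLinearMap.comp_apply,
      ContinuousLinearMap.flip_apply]
    ring
  rw [coordHess_apply, hD2, ← toCoord_grad hf hx, koszul, mvfderiv_inner hx hY hW,
    mvfderiv_inner hx hW hV, mvfderiv_inner hx hV hY, ← gram_toCoord hx, ← gram_toCoord hx,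
    ← gram_toCoord hx, toCoord_mlieBracket hx hV hY, toCoord_mlieBracket hx hV hW,
    toCoord_mlieBracket hx hY hW]
  -- The derivatives of `V` and `W` cancel between the product rule and the brackets, once the
  -- symmetry of `G` and of its derivative aligns the terms.
  simp only [map_sub, sub_apply]
  have g := gram_symm (c := c) (extChartAt 𝓘(ℝ, E) c x)
  rw [g _ (fderiv ℝ (coordField c W) (extChartAt 𝓘(ℝ, E) c x) (toCoord c x (V x))),
    g _ (fderiv ℝ (coordField c V) (extChartAt 𝓘(ℝ, E) c x) (toCoord c x (grad E f x))),
    g (toCoord c x (V x)) (fderiv ℝ (coordField c (grad E f)) (extChartAt 𝓘(ℝ, E) c x) _),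
    hsymm (toCoord c x (grad E f x)) (toCoord c x (W x)),
    hsymm (toCoord c x (W x)) (toCoord c x (V x))]
  ring

/-- The Riemannian Hessian, read in the chart at `c`. -/
theorem inner_hess (hf : ContMDiff 𝓘(ℝ, E) 𝓘(ℝ, ℝ) 2 f) (hx : x ∈ (chartAt E c).source)
    (v w : TangentSpace 𝓘(ℝ, E) x) :
    inner ℝ (hess E f x v) w = coordHess (gram c) (f ∘ (extChartAt 𝓘(ℝ, E) c).symm)
      (extChartAt 𝓘(ℝ, E) c x) (toCoord c x v) (toCoord c x w) := by
  set b := stdOrthonormalBasis ℝ (TangentSpace 𝓘(ℝ, E) x) with hb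
  -- Only differentiability of the extensions matters: by `koszul_grad` the result depends on them
  -- through their values at `x` alone.
  have hext : ∀ v : TangentSpace 𝓘(ℝ, E) x, MDifferentiableAt 𝓘(ℝ, E) 𝓘(ℝ, E).tangent
      (fun y => (⟨y, FiberBundle.extend E v y⟩ : TangentBundle 𝓘(ℝ, E) M)) x :=
    fun v => FiberBundle.mdifferentiableAt_extend 𝓘(ℝ, E) E v
  have h1 : hess E f x v = ∑ i, coordHess (gram c) (f ∘ (extChartAt 𝓘(ℝ, E) c).symm)
      (extChartAt 𝓘(ℝ, E) c x) (toCoord c x v) (toCoord c x (b i)) • b i := by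
    rw [hess, leviCivita]
    refine Finset.sum_congr rfl fun i _ => ?_
    rw [koszul_grad hf hx (hext v) (hext (b i)), FiberBundle.extend_apply_self,
      FiberBundle.extend_apply_self]
  rw [h1, sum_inner]
  conv_rhs => rw [← b.sum_repr' w]
  simp only [map_sum, map_smul, inner_smul_left, smul_eq_mul, RCLike.conj_to_real]
  exact Finset.sum_congr rfl fun i _ => mul_comm _ _

theorem hess_symm (hf : ContMDiff 𝓘(ℝ, E) 𝓘(ℝ, ℝ) 2 f) (x : M) (v w : TangentSpace 𝓘(ℝ, E) x) :
    inner ℝ (hess E f x v) w = (inner ℝ v (hess E f x w) : ℝ) := by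
  have hx := mem_chart_source E x
  have hu := mem_target_of_mem_source hx
  rw [real_inner_comm _ v, inner_hess hf hx, inner_hess hf hx, coordHess_symm
    (contDiffAt_comp_extChartAt_symm hf hu) ((contDiffAt_gram_one hu).differentiableAt
    (by norm_num)) (Eventually.of_forall fun w a b => gram_symm w a b)]

theorem exists_linearMap_eq_hess (hf : ContMDiff 𝓘(ℝ, E) 𝓘(ℝ, ℝ) 2 f) (x : M) :
    ∃ H : TangentSpace 𝓘(ℝ, E) x →ₗ[ℝ] TangentSpace 𝓘(ℝ, E) x, ⇑H = hess E f x := by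
  have hx := mem_chart_source E x
  refine ⟨⟨⟨hess E f x, fun v w => ?_⟩, fun a v => ?_⟩, rfl⟩
  · refine ext_inner_right ℝ fun z => ?_
    rw [inner_add_left, inner_hess hf hx, inner_hess hf hx, inner_hess hf hx]
    simp
  · refine ext_inner_right ℝ fun z => ?_
    simp only [RingHom.id_apply]
    rw [inner_smul_left, inner_hess hf hx, inner_hess hf hx]
    simp

end Hessian

/-! ### Riemannian distance and chart distance -/

section Distance

variable {E : Type*} [NormedAddCommGroup E] [NormedSpace ℝ E]
  {M : Type*} [EMetricSpace M] [ChartedSpace E M] [IsManifold 𝓘(ℝ, E) ∞ M]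
  [RiemannianBundle (fun x : M => TangentSpace 𝓘(ℝ, E) x)]
  [IsContMDiffRiemannianBundle 𝓘(ℝ, E) ∞ E (fun x : M => TangentSpace 𝓘(ℝ, E) x)]

theorem isContinuousRiemannianBundle :
    IsContinuousRiemannianBundle E (fun x : M => TangentSpace 𝓘(ℝ, E) x) := by
  obtain ⟨g, hg, h⟩ := IsContMDiffRiemannianBundle.exists_contMDiff (IB := 𝓘(ℝ, E)) (n := ∞) (F := E)
    (E := fun x : M => TangentSpace 𝓘(ℝ, E) x)
  exact ⟨g, hg.continuous, h⟩

theorem exists_norm_toCoord_le (c : M) : ∃ C > 0, ∀ᶠ y in 𝓝 c,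
    ∀ v : TangentSpace 𝓘(ℝ, E) y, ‖toCoord c y v‖ ≤ C * ‖v‖ := by
  have := isContinuousRiemannianBundle (E := E) (M := M)
  obtain ⟨C, hC, h⟩ := eventually_norm_trivializationAt_lt E
    (fun x : M => TangentSpace 𝓘(ℝ, E) x) c
  refine ⟨C, hC, h.mono fun y hy v => ?_⟩
  exact ContinuousLinearMap.le_of_opNorm_le _ hy.le v

theorem exists_norm_ofCoord_le (c : M) : ∃ C > 0, ∀ᶠ y in 𝓝 c,
    ∀ a : E, ‖ofCoord c y a‖ ≤ C * ‖a‖ := by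
  have := isContinuousRiemannianBundle (E := E) (M := M)
  obtain ⟨C, hC, h⟩ := eventually_norm_symmL_trivializationAt_lt E
    (fun x : M => TangentSpace 𝓘(ℝ, E) x) c
  refine ⟨C, hC, h.mono fun y hy v => ?_⟩
  exact ContinuousLinearMap.le_of_opNorm_le _ hy.le v

variable [IsRiemannianManifold 𝓘(ℝ, E) M]

theorem exists_edist_le_norm_extChartAt (c : M) : ∃ C > 0, ∀ᶠ y in 𝓝 c,
    edist c y ≤ ENNReal.ofReal (C * ‖extChartAt 𝓘(ℝ, E) c y - extChartAt 𝓘(ℝ, E) c c‖) := by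
  have := isContinuousRiemannianBundle (E := E) (M := M)
  have : IsManifold 𝓘(ℝ, E) 1 M := IsManifold.of_le (n := ∞) ENat.LEInfty.out
  obtain ⟨C, hC, h⟩ := eventually_riemannianEDist_le_edist_extChartAt 𝓘(ℝ, E) c
  refine ⟨C, by exact_mod_cast hC, h.mono fun y hy => ?_⟩
  rw [IsRiemannianManifold.out (I := 𝓘(ℝ, E)) c y]
  refine hy.trans (le_of_eq ?_)
  rw [ENNReal.ofReal_mul C.coe_nonneg, ENNReal.ofReal_coe_nnreal, edist_dist, dist_comm,
    dist_eq_norm]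

/-- Curves from `c` of small length have chart images of comparable length. -/
theorem exists_norm_extChartAt_le_edist (c : M) : ∃ C > 0, ∀ᶠ y in 𝓝 c,
    ENNReal.ofReal ‖extChartAt 𝓘(ℝ, E) c y - extChartAt 𝓘(ℝ, E) c c‖ ≤
      ENNReal.ofReal C * edist c y := by
  have := isContinuousRiemannianBundle (E := E) (M := M)
  have : IsManifold 𝓘(ℝ, E) 1 M := IsManifold.of_le (n := ∞) ENat.LEInfty.out
  obtain ⟨C, hC, hnorm⟩ := exists_norm_toCoord_le (E := E) c
  refine ⟨C, hC, ?_⟩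
  -- The radius `r` is such that the ball around `c` lies in the chart domain and in the region
  -- where `toCoord` is bounded by `C`.
  obtain ⟨r, hr, hrs⟩ := setOfPred_riemannianEDist_lt_subset_nhds' 𝓘(ℝ, E)
    (inter_mem hnorm ((chartAt E c).open_source.mem_nhds (mem_chart_source E c)))
  filter_upwards [eventually_riemannianEDist_lt 𝓘(ℝ, E) c hr] with y hy
  rw [IsRiemannianManifold.out (I := 𝓘(ℝ, E)) c y, mul_comm]
  have hC0 : ENNReal.ofReal C ≠ 0 := by simpa using hC
  rw [← ENNReal.div_le_iff_le_mul (Or.inl hC0) (Or.inl ENNReal.ofReal_ne_top)]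
  refine le_of_forall_gt fun L hL => ?_
  obtain ⟨γ, hγ0, hγ1, hγ, hlen⟩ := exists_lt_of_riemannianEDist_lt (lt_min hL hy)
  refine lt_of_le_of_lt ?_ (hlen.trans_le (min_le_left _ _))
  -- A curve from `c` shorter than `r` cannot leave the ball, since the distance to `γ t` is at most
  -- the length of its initial piece.
  have hmem : ∀ t ∈ Icc (0 : ℝ) 1, γ t ∈ {y | ∀ v : TangentSpace 𝓘(ℝ, E) y,
      ‖toCoord c y v‖ ≤ C * ‖v‖} ∩ (chartAt E c).source := by
    intro t ht
    refine hrs (lt_of_le_of_lt ?_ (hlen.trans_le (min_le_right _ _)))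
    exact (riemannianEDist_le_pathELength (hγ.mono (Icc_subset_Icc_right ht.2)) hγ0 rfl
      ht.1).trans (pathELength_mono le_rfl ht.2)
  have hφγ : ContDiffOn ℝ 1 (extChartAt 𝓘(ℝ, E) c ∘ γ) (Icc 0 1) := by
    rw [← contMDiffOn_iff_contDiffOn]
    exact contMDiffOn_extChartAt.comp (t := (chartAt E c).source) hγ fun t ht => (hmem t ht).2
  rw [ENNReal.div_le_iff_le_mul (Or.inl hC0) (Or.inl ENNReal.ofReal_ne_top), mul_comm]
  have e1 : ENNReal.ofReal ‖extChartAt 𝓘(ℝ, E) c y - extChartAt 𝓘(ℝ, E) c c‖ =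
      ‖(extChartAt 𝓘(ℝ, E) c ∘ γ) 1 - (extChartAt 𝓘(ℝ, E) c ∘ γ) 0‖ₑ := by
    rw [ofReal_norm, Function.comp_apply, Function.comp_apply, hγ0, hγ1]
  rw [e1]
  refine (enorm_sub_le_lintegral_derivWithin_Icc_of_contDiffOn_Icc hφγ zero_le_one).trans ?_
  rw [pathELength_eq_lintegral_mfderivWithin_Icc,
    ← MeasureTheory.lintegral_const_mul' _ _ ENNReal.ofReal_ne_top]
  refine MeasureTheory.setLIntegral_mono' measurableSet_Icc fun t ht => ?_
  have h1 : mfderivWithin 𝓘(ℝ, ℝ) 𝓘(ℝ, E) (extChartAt 𝓘(ℝ, E) c ∘ γ) (Icc 0 1) t =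
      (mfderiv 𝓘(ℝ, E) 𝓘(ℝ, E) (extChartAt 𝓘(ℝ, E) c) (γ t)) ∘L
        (mfderivWithin 𝓘(ℝ, ℝ) 𝓘(ℝ, E) γ (Icc 0 1) t) := by
    apply mfderiv_comp_mfderivWithin
    · exact mdifferentiableAt_extChartAt (hmem t ht).2
    · exact (hγ.mdifferentiableOn one_ne_zero) _ ht
    · rw [uniqueMDiffWithinAt_iff_uniqueDiffWithinAt]
      exact uniqueDiffOn_Icc zero_lt_one _ ht
  have h2 : derivWithin (extChartAt 𝓘(ℝ, E) c ∘ γ) (Icc 0 1) t =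
      toCoord c (γ t) (mfderivWithin 𝓘(ℝ, ℝ) 𝓘(ℝ, E) γ (Icc 0 1) t (1 : ℝ)) := by
    rw [← fderivWithin_derivWithin, ← mfderivWithin_eq_fderivWithin]
    exact (congrArg (fun L : ℝ →L[ℝ] E => L 1) h1).trans
      (congrArg (fun L : TangentSpace 𝓘(ℝ, E) (γ t) →L[ℝ] E =>
        L (mfderivWithin 𝓘(ℝ, ℝ) 𝓘(ℝ, E) γ (Icc 0 1) t (1 : ℝ)))
        (toCoord_eq_mfderiv (hmem t ht).2).symm)
  rw [h2, ← ofReal_norm, ← ofReal_norm, ← ENNReal.ofReal_mul hC.le]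
  exact ENNReal.ofReal_le_ofReal ((hmem t ht).1 _)

end Distance

/-! ### Retractions in coordinates and derivatives of pullbacks -/

section Retraction

variable {E : Type*} [NormedAddCommGroup E] [NormedSpace ℝ E]
  {M : Type*} [EMetricSpace M] [ChartedSpace E M] [IsManifold 𝓘(ℝ, E) ∞ M]
  {R : (x : M) → TangentSpace 𝓘(ℝ, E) x → M} {f : M → ℝ} {c x : M}

/-- The retraction, read in the chart at `c` and the corresponding trivialization. -/
def coordRetraction (R : (x : M) → TangentSpace 𝓘(ℝ, E) x → M) (c : M) (p : E × E) : E :=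
  extChartAt 𝓘(ℝ, E) c (R ((extChartAt 𝓘(ℝ, E) c).symm p.1)
    (ofCoord c ((extChartAt 𝓘(ℝ, E) c).symm p.1) p.2))

theorem contMDiffAt_ofCoord {p : E × E} (hp : p.1 ∈ (extChartAt 𝓘(ℝ, E) c).target) :
    ContMDiffAt 𝓘(ℝ, E × E) 𝓘(ℝ, E).tangent ∞ (fun p : E × E =>
      (⟨(extChartAt 𝓘(ℝ, E) c).symm p.1, ofCoord c ((extChartAt 𝓘(ℝ, E) c).symm p.1) p.2⟩ :
        TangentBundle 𝓘(ℝ, E) M)) p := by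
  have hfst : ContMDiffAt 𝓘(ℝ, E × E) 𝓘(ℝ, E) ∞ (Prod.fst : E × E → E) p :=
    contDiff_fst.contDiffAt.contMDiffAt
  refine ((trivializationAt E (TangentSpace 𝓘(ℝ, E)) c).contMDiffAt_iff
    (f := fun p : E × E => (⟨(extChartAt 𝓘(ℝ, E) c).symm p.1,
      ofCoord c ((extChartAt 𝓘(ℝ, E) c).symm p.1) p.2⟩ : TangentBundle 𝓘(ℝ, E) M))
    ((Trivialization.coe_mem_source _).2 (mem_source_of_mem_target hp))).2
    ⟨(contMDiffAt_extChartAt_symm hp).comp p hfst, ?_⟩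
  refine (contDiff_snd.contDiffAt.contMDiffAt :
    ContMDiffAt 𝓘(ℝ, E × E) 𝓘(ℝ, E) ∞ (Prod.snd : E × E → E) p).congr_of_eventuallyEq ?_
  filter_upwards [continuousAt_fst ((isOpen_extChartAt_target c).mem_nhds hp)] with q hq
  exact (toCoord_apply (mem_source_of_mem_target hq) _).symm.trans
    (toCoord_ofCoord (mem_source_of_mem_target hq) _)

theorem coordRetraction_zero (hR : IsRetraction R) {u : E}
    (hu : u ∈ (extChartAt 𝓘(ℝ, E) c).target) : coordRetraction R c (u, 0) = u := by
  rw [coordRetraction, map_zero, hR.map_zero]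
  exact (extChartAt 𝓘(ℝ, E) c).right_inv hu

theorem comp_coordRetraction {p : E × E}
    (hp : R ((extChartAt 𝓘(ℝ, E) c).symm p.1)
      (ofCoord c ((extChartAt 𝓘(ℝ, E) c).symm p.1) p.2) ∈ (chartAt E c).source) :
    ((f ∘ (extChartAt 𝓘(ℝ, E) c).symm) ∘ coordRetraction R c) p =
      pullback R f ((extChartAt 𝓘(ℝ, E) c).symm p.1)
        (ofCoord c ((extChartAt 𝓘(ℝ, E) c).symm p.1) p.2) := by
  simp only [Function.comp_apply, coordRetraction, extChartAt_symm_apply hp, pullback]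

theorem contMDiffAt_retraction (hR : IsRetraction R) {p : E × E}
    (hp : p.1 ∈ (extChartAt 𝓘(ℝ, E) c).target) :
    ContMDiffAt 𝓘(ℝ, E × E) 𝓘(ℝ, E) 2 (fun p : E × E => R ((extChartAt 𝓘(ℝ, E) c).symm p.1)
      (ofCoord c ((extChartAt 𝓘(ℝ, E) c).symm p.1) p.2)) p :=
  hR.contMDiff.contMDiffAt.comp p ((contMDiffAt_ofCoord hp).of_le ENat.LEInfty.out)

theorem contDiffAt_coordRetraction (hR : IsRetraction R) {p : E × E}
    (hp : p.1 ∈ (extChartAt 𝓘(ℝ, E) c).target)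
    (hp' : R ((extChartAt 𝓘(ℝ, E) c).symm p.1)
      (ofCoord c ((extChartAt 𝓘(ℝ, E) c).symm p.1) p.2) ∈ (chartAt E c).source) :
    ContDiffAt ℝ 2 (coordRetraction R c) p :=
  ((contMDiffAt_extChartAt' hp').comp p (contMDiffAt_retraction hR hp)).contDiffAt

theorem eventually_mem_source_retraction (hR : IsRetraction R) (c : M) :
    ∀ᶠ p : E × E in 𝓝 (extChartAt 𝓘(ℝ, E) c c, 0), p.1 ∈ (extChartAt 𝓘(ℝ, E) c).target ∧
      R ((extChartAt 𝓘(ℝ, E) c).symm p.1)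
        (ofCoord c ((extChartAt 𝓘(ℝ, E) c).symm p.1) p.2) ∈ (chartAt E c).source := by
  have hc := mem_chart_source E c
  have hu := mem_target_of_mem_source hc
  have h0 : ContinuousAt (Prod.fst : E × E → E) (extChartAt 𝓘(ℝ, E) c c, 0) := continuousAt_fst
  refine (h0.eventually ((isOpen_extChartAt_target c).mem_nhds hu)).and ?_
  have h := (contMDiffAt_retraction hR (p := (extChartAt 𝓘(ℝ, E) c c, (0 : E))) hu).continuousAt
  refine h ((chartAt E c).open_source.mem_nhds ?_)
  simp only
  rw [map_zero, hR.map_zero, extChartAt_symm_apply hc]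
  exact hc

variable [RiemannianBundle (fun x : M => TangentSpace 𝓘(ℝ, E) x)]

/-- The fibre carries the Riemannian norm, the bundle is modelled on `E`; a trivialization reads the
inclusion as the continuous linear map `toCoord`. -/
theorem contMDiff_tangentSpace_inclusion (x : M) :
    ContMDiff 𝓘(ℝ, TangentSpace 𝓘(ℝ, E) x) 𝓘(ℝ, E).tangent ∞
      (fun ξ : TangentSpace 𝓘(ℝ, E) x => (⟨x, ξ⟩ : TangentBundle 𝓘(ℝ, E) M)) := by
  intro ξ
  refine ((trivializationAt E (TangentSpace 𝓘(ℝ, E)) x).contMDiffAt_iff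
    (f := fun ξ : TangentSpace 𝓘(ℝ, E) x => (⟨x, ξ⟩ : TangentBundle 𝓘(ℝ, E) M))
    ((Trivialization.coe_mem_source _).2 (mem_chart_source E x))).2 ⟨contMDiffAt_const, ?_⟩
  have h : ContMDiff 𝓘(ℝ, TangentSpace 𝓘(ℝ, E) x) 𝓘(ℝ, E) ∞ (toCoord x x) :=
    (ContinuousLinearMap.contDiff (E := TangentSpace 𝓘(ℝ, E) x) (toCoord x x)).contMDiff
  refine (h ξ).congr_of_eventuallyEq (Eventually.of_forall fun ζ => ?_)
  exact (toCoord_apply (mem_chart_source E x) ζ).symm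

theorem IsRetraction.contMDiff_fiber (hR : IsRetraction R) (x : M) :
    ContMDiff 𝓘(ℝ, TangentSpace 𝓘(ℝ, E) x) 𝓘(ℝ, E) 2 (R x) :=
  hR.contMDiff.comp ((contMDiff_tangentSpace_inclusion x).of_le ENat.LEInfty.out)

theorem IsRetraction.contDiff_pullback (hR : IsRetraction R)
    (hf : ContMDiff 𝓘(ℝ, E) 𝓘(ℝ, ℝ) 2 f) (x : M) : ContDiff ℝ 2 (pullback R f x) :=
  (hf.comp (hR.contMDiff_fiber x)).contDiff

/-- The chain rule for tangent maps applied to the velocity condition. The general target `F` serves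
both the objective `f` and the chart map. -/
theorem IsRetraction.hasDerivAt_comp_smul (hR : IsRetraction R) {F : Type*} [NormedAddCommGroup F]
    [NormedSpace ℝ F] {g : M → F} (hg : MDifferentiableAt 𝓘(ℝ, E) 𝓘(ℝ, F) g x)
    (v : TangentSpace 𝓘(ℝ, E) x) :
    HasDerivAt (fun s : ℝ => g (R x (s • v))) (mfderiv 𝓘(ℝ, E) 𝓘(ℝ, F) g x v) 0 := by
  have h0 : R x ((0 : ℝ) • v) = x := by rw [zero_smul, hR.map_zero]
  have hline : ContMDiff 𝓘(ℝ, ℝ) 𝓘(ℝ, TangentSpace 𝓘(ℝ, E) x) 2 (fun s : ℝ => s • v) :=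
    (contDiff_id.smul contDiff_const).contMDiff
  have hc : MDifferentiableAt 𝓘(ℝ, ℝ) 𝓘(ℝ, E) (fun s : ℝ => R x (s • v)) 0 :=
    (((hR.contMDiff_fiber x).comp hline) 0).mdifferentiableAt (by norm_num)
  have hg' : MDifferentiableAt 𝓘(ℝ, E) 𝓘(ℝ, F) g (R x ((0 : ℝ) • v)) := by rwa [h0]
  have hcomp := tangentMap_comp_at (I := 𝓘(ℝ, ℝ)) (I' := 𝓘(ℝ, E)) (I'' := 𝓘(ℝ, F))
    (g := g) (f := fun s : ℝ => R x (s • v)) ⟨0, (1 : ℝ)⟩ hg' hc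
  rw [hR.velocity x v] at hcomp
  have hd : DifferentiableAt ℝ (g ∘ fun s : ℝ => R x (s • v)) 0 := (hg'.comp 0 hc).differentiableAt
  have h1 : mfderiv 𝓘(ℝ, ℝ) 𝓘(ℝ, F) (g ∘ fun s : ℝ => R x (s • v)) 0 (1 : ℝ) =
      (mfderiv 𝓘(ℝ, E) 𝓘(ℝ, F) g x v : F) :=
    congrArg (fun p : TangentBundle 𝓘(ℝ, F) F => (p.2 : F)) hcomp
  rw [mfderiv_eq_fderiv] at h1
  have h2 := hd.hasDerivAt
  rw [← fderiv_apply_one_eq_deriv] at h2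
  exact h1 ▸ h2

theorem fderiv_coordRetraction (hR : IsRetraction R) (c : M) :
    fderiv ℝ (coordRetraction R c) (extChartAt 𝓘(ℝ, E) c c, 0) ∘L ContinuousLinearMap.inr ℝ E E =
      ContinuousLinearMap.id ℝ E := by
  have hc := mem_chart_source E c
  have hu := mem_target_of_mem_source hc
  have hd : DifferentiableAt ℝ (coordRetraction R c) (extChartAt 𝓘(ℝ, E) c c, 0) :=
    (contDiffAt_coordRetraction hR hu (by
      rw [map_zero, hR.map_zero, extChartAt_symm_apply hc]; exact hc)).differentiableAt
      (by norm_num)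
  ext a
  have h1 : HasDerivAt (fun s : ℝ => (extChartAt 𝓘(ℝ, E) c c, s • a)) ((0 : E), a) 0 := by
    simpa using (hasDerivAt_const (0 : ℝ) (extChartAt 𝓘(ℝ, E) c c)).prodMk
      ((hasDerivAt_id (0 : ℝ)).smul_const a)
  have h2 : HasFDerivAt (coordRetraction R c) (fderiv ℝ (coordRetraction R c)
      (extChartAt 𝓘(ℝ, E) c c, 0)) (extChartAt 𝓘(ℝ, E) c c, (0 : ℝ) • a) := by
    rw [zero_smul]; exact hd.hasFDerivAt
  have h3 := h2.comp_hasDerivAt (0 : ℝ) h1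
  have h4 := hR.hasDerivAt_comp_smul (mdifferentiableAt_extChartAt (I := 𝓘(ℝ, E)) hc)
    (ofCoord c c a)
  have h5 : (coordRetraction R c ∘ fun s : ℝ => (extChartAt 𝓘(ℝ, E) c c, s • a)) =
      fun s : ℝ => extChartAt 𝓘(ℝ, E) c (R c (s • ofCoord c c a)) := by
    funext s
    simp only [Function.comp_apply, coordRetraction, map_smul]
    rw [extChartAt_symm_apply hc]
  rw [h5] at h3
  have h6 : mfderiv 𝓘(ℝ, E) 𝓘(ℝ, E) (extChartAt 𝓘(ℝ, E) c) c (ofCoord c c a) = a :=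
    (congrArg (fun L : TangentSpace 𝓘(ℝ, E) c →L[ℝ] E => L (ofCoord c c a))
      (toCoord_eq_mfderiv hc).symm).trans (toCoord_ofCoord hc a)
  exact (h3.unique h4).trans h6

/-- This passes from the varying spaces `T_y M` to calculus on the fixed space `E × E`, where
uniformity in `y` becomes a neighbourhood statement. -/
theorem fderiv_pullback_eq_partialSnd (hR : IsRetraction R)
    (hf : ContMDiff 𝓘(ℝ, E) 𝓘(ℝ, ℝ) 2 f) (c : M) :
    ∀ᶠ p : E × E in 𝓝 (extChartAt 𝓘(ℝ, E) c c, 0),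
      partialSnd ((f ∘ (extChartAt 𝓘(ℝ, E) c).symm) ∘ coordRetraction R c) p =
        fderiv ℝ (pullback R f ((extChartAt 𝓘(ℝ, E) c).symm p.1))
          (ofCoord c ((extChartAt 𝓘(ℝ, E) c).symm p.1) p.2) ∘L
          ofCoord c ((extChartAt 𝓘(ℝ, E) c).symm p.1) := by
  filter_upwards [eventually_eventually_nhds.2 (eventually_mem_source_retraction hR c)] with p hp
  obtain ⟨hp1, hp2⟩ := hp.self_of_nhds
  set y := (extChartAt 𝓘(ℝ, E) c).symm p.1 with hy
  have hd : DifferentiableAt ℝ ((f ∘ (extChartAt 𝓘(ℝ, E) c).symm) ∘ coordRetraction R c)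
      (p.1, p.2) :=
    (ContDiffAt.comp p (contDiffAt_comp_extChartAt_symm hf (mem_target_of_mem_source hp2))
      (contDiffAt_coordRetraction hR hp1 hp2)).differentiableAt (by norm_num)
  have h1 : HasFDerivAt (fun a : E => (p.1, a)) (ContinuousLinearMap.inr ℝ E E) p.2 :=
    hasFDerivAt_prodMk_right p.1 p.2
  have h2 := hd.hasFDerivAt.comp p.2 h1
  have h3 : HasFDerivAt (fun a : E => pullback R f y (ofCoord c y a)) _ p.2 :=
    (((hR.contDiff_pullback hf y).differentiable (by norm_num)
      (ofCoord c y p.2)).hasFDerivAt).comp p.2 (ofCoord c y).hasFDerivAt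
  have h4 : (fun a : E => pullback R f y (ofCoord c y a)) =ᶠ[𝓝 p.2]
      (((f ∘ (extChartAt 𝓘(ℝ, E) c).symm) ∘ coordRetraction R c) ∘ fun a : E => (p.1, a)) := by
    have h5 : ContinuousAt (fun a : E => (p.1, a)) p.2 := by fun_prop
    filter_upwards [h5.eventually hp] with a ha
    exact (comp_coordRetraction (p := (p.1, a)) ha.2).symm
  exact (h2.congr_of_eventuallyEq h4).unique h3

variable [FiniteDimensional ℝ E]

theorem IsRetraction.hasDerivAt_pullback (hR : IsRetraction R)
    (hf : ContMDiff 𝓘(ℝ, E) 𝓘(ℝ, ℝ) 2 f) (v : TangentSpace 𝓘(ℝ, E) x) :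
    HasDerivAt (fun s : ℝ => f (R x (s • v))) (inner ℝ (grad E f x) v) 0 := by
  rw [inner_grad]
  exact hR.hasDerivAt_comp_smul ((hf x).mdifferentiableAt (by norm_num)) v

theorem IsRetraction.fderiv_pullback_zero (hR : IsRetraction R)
    (hf : ContMDiff 𝓘(ℝ, E) 𝓘(ℝ, ℝ) 2 f) (v : TangentSpace 𝓘(ℝ, E) x) :
    fderiv ℝ (pullback R f x) 0 v = inner ℝ (grad E f x) v := by
  have h1 : HasFDerivAt (pullback R f x) (fderiv ℝ (pullback R f x) 0)
      ((0 : ℝ) • v) := by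
    rw [zero_smul]
    exact ((hR.contDiff_pullback hf x).differentiable (by norm_num) 0).hasFDerivAt
  have h2 : HasDerivAt (fun s : ℝ => s • v) v 0 := by
    simpa using (hasDerivAt_id (0 : ℝ)).smul_const v
  have h3 := h1.comp_hasDerivAt (0 : ℝ) h2
  exact h3.unique (hR.hasDerivAt_pullback hf v)

end Retraction

/-! ### Uniform estimates near a nondegenerate critical point -/

section Local

variable {E : Type*} [NormedAddCommGroup E] [NormedSpace ℝ E]
  {M : Type*} [EMetricSpace M] [ChartedSpace E M] [IsManifold 𝓘(ℝ, E) ∞ M]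
  [RiemannianBundle (fun x : M => TangentSpace 𝓘(ℝ, E) x)]
  {R : (x : M) → TangentSpace 𝓘(ℝ, E) x → M} {f : M → ℝ} {c : M}

/-- A property of coordinate pairs near `(φ c, 0)` holds for the coordinates of all short tangent
vectors near `c`. -/
theorem eventually_toCoord
    [IsContMDiffRiemannianBundle 𝓘(ℝ, E) ∞ E (fun x : M => TangentSpace 𝓘(ℝ, E) x)] {Q : E × E → Prop}
    (hQ : ∀ᶠ p in 𝓝 ((extChartAt 𝓘(ℝ, E) c c, 0) : E × E), Q p) :
    ∃ ρ > 0, ∀ᶠ y in 𝓝 c, ∀ ξ : TangentSpace 𝓘(ℝ, E) y, ‖ξ‖ ≤ ρ →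
      Q (extChartAt 𝓘(ℝ, E) c y, toCoord c y ξ) := by
  obtain ⟨C, hC, h⟩ := exists_norm_toCoord_le (E := E) c
  rw [nhds_prod_eq, eventually_prod_iff] at hQ
  obtain ⟨pa, ha, pb, hb, hab⟩ := hQ
  obtain ⟨r, hr, hrb⟩ := Metric.eventually_nhds_iff.1 hb
  have hφ : Tendsto (extChartAt 𝓘(ℝ, E) c) (𝓝 c) (𝓝 (extChartAt 𝓘(ℝ, E) c c)) :=
    continuousAt_extChartAt c
  refine ⟨r / (2 * C), by positivity, ?_⟩
  filter_upwards [hφ.eventually ha, h] with y hy hy' ξ hξ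
  refine hab hy (hrb ?_)
  rw [dist_zero_right]
  calc ‖toCoord c y ξ‖ ≤ C * (r / (2 * C)) := (hy' ξ).trans (by gcongr)
    _ = r / 2 := by field_simp
    _ < r := by linarith

variable [FiniteDimensional ℝ E]

theorem inner_grad_eq_fderiv (hf : ContMDiff 𝓘(ℝ, E) 𝓘(ℝ, ℝ) 2 f) {y : M}
    (hy : y ∈ (chartAt E c).source) (v : TangentSpace 𝓘(ℝ, E) y) :
    inner ℝ (grad E f y) v = fderiv ℝ (f ∘ (extChartAt 𝓘(ℝ, E) c).symm)
      (extChartAt 𝓘(ℝ, E) c y) (toCoord c y v) := by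
  rw [inner_grad, mvfderiv_eq_fderiv_of_contMDiff hf hy]

variable [IsContMDiffRiemannianBundle 𝓘(ℝ, E) ∞ E (fun x : M => TangentSpace 𝓘(ℝ, E) x)]

/-- The gradient represents the differential, and the passage to coordinates is bounded in both
directions near `c`. -/
theorem exists_norm_grad_comparable (hf : ContMDiff 𝓘(ℝ, E) 𝓘(ℝ, ℝ) 2 f) (c : M) :
    ∃ C > 0, ∀ᶠ y in 𝓝 c,
      ‖fderiv ℝ (f ∘ (extChartAt 𝓘(ℝ, E) c).symm) (extChartAt 𝓘(ℝ, E) c y)‖ ≤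
        C * ‖grad E f y‖ ∧
      ‖grad E f y‖ ≤
        C * ‖fderiv ℝ (f ∘ (extChartAt 𝓘(ℝ, E) c).symm) (extChartAt 𝓘(ℝ, E) c y)‖ := by
  obtain ⟨C₁, hC₁, h₁⟩ := exists_norm_toCoord_le (E := E) c
  obtain ⟨C₂, hC₂, h₂⟩ := exists_norm_ofCoord_le (E := E) c
  refine ⟨max C₁ C₂, lt_max_of_lt_left hC₁, ?_⟩
  filter_upwards [h₁, h₂, (chartAt E c).open_source.mem_nhds (mem_chart_source E c)]
    with y hy₁ hy₂ hy
  set L := fderiv ℝ (f ∘ (extChartAt 𝓘(ℝ, E) c).symm) (extChartAt 𝓘(ℝ, E) c y) with hL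
  constructor
  · refine ContinuousLinearMap.opNorm_le_bound _ (by positivity) fun a => ?_
    have h := inner_grad_eq_fderiv hf hy (ofCoord c y a)
    rw [toCoord_ofCoord hy, ← hL] at h
    rw [← h]
    refine (norm_inner_le_norm _ _).trans ?_
    calc ‖grad E f y‖ * ‖ofCoord c y a‖ ≤ ‖grad E f y‖ * (max C₁ C₂ * ‖a‖) := by
          gcongr
          exact (hy₂ a).trans (by gcongr; exact le_max_right _ _)
      _ = max C₁ C₂ * ‖grad E f y‖ * ‖a‖ := by ring
  · have h := inner_grad_eq_fderiv hf hy (grad E f y)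
    rw [← hL, real_inner_self_eq_norm_sq] at h
    have h3 : ‖grad E f y‖ ^ 2 ≤ max C₁ C₂ * ‖L‖ * ‖grad E f y‖ := by
      rw [h]
      refine (le_abs_self _).trans ((L.le_opNorm _).trans ?_)
      calc ‖L‖ * ‖toCoord c y (grad E f y)‖ ≤ ‖L‖ * (max C₁ C₂ * ‖grad E f y‖) := by
            gcongr
            exact (hy₁ _).trans (by gcongr; exact le_max_left _ _)
        _ = _ := by ring
    rcases (norm_nonneg (grad E f y)).eq_or_lt with h0 | h0
    · rw [← h0]; positivity
    · rw [sq] at h3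
      exact le_of_mul_le_mul_right h3 h0

theorem continuousAt_coordHess_extChartAt (hf : ContMDiff 𝓘(ℝ, E) 𝓘(ℝ, ℝ) 2 f) (c : M) :
    ContinuousAt (coordHess (gram c) (f ∘ (extChartAt 𝓘(ℝ, E) c).symm))
      (extChartAt 𝓘(ℝ, E) c c) := by
  have hu := mem_target_of_mem_source (mem_chart_source E c)
  exact continuousAt_coordHess (gram_pos hu) (contDiffAt_gram_one hu)
    (contDiffAt_comp_extChartAt_symm hf hu)

/-- Near a point where `Hess f` is positive definite and exceeds `κ`, it is uniformly so. -/
theorem exists_hess_bounds (hf : ContMDiff 𝓘(ℝ, E) 𝓘(ℝ, ℝ) 2 f) {κ : ℝ}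
    (hpos : ∀ v : TangentSpace 𝓘(ℝ, E) c, v ≠ 0 → 0 < inner ℝ (hess E f c v) v)
    (hκ : ∀ v : TangentSpace 𝓘(ℝ, E) c, v ≠ 0 → κ * ‖v‖ ^ 2 < inner ℝ (hess E f c v) v) :
    ∃ m > 0, ∃ Λ > 0, ∀ᶠ y in 𝓝 c, ∀ v : TangentSpace 𝓘(ℝ, E) y,
      m * ‖v‖ ^ 2 ≤ inner ℝ (hess E f y v) v ∧ inner ℝ (hess E f y v) v ≤ Λ * ‖v‖ ^ 2 ∧
      (v ≠ 0 → κ * ‖v‖ ^ 2 < inner ℝ (hess E f y v) v) := by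
  have hc := mem_chart_source E c
  have hu := mem_target_of_mem_source hc
  set B := coordHess (gram c) (f ∘ (extChartAt 𝓘(ℝ, E) c).symm) with hB
  have hBc := continuousAt_coordHess_extChartAt hf c
  rw [← hB] at hBc
  have hof : ∀ a : E, a ≠ 0 → ofCoord c c a ≠ 0 := fun a ha h => ha (by
    rw [← toCoord_ofCoord hc a, h, map_zero])
  have hinner : ∀ a : E, inner ℝ (hess E f c (ofCoord c c a)) (ofCoord c c a) =
      B (extChartAt 𝓘(ℝ, E) c c) a a := fun a => by
    rw [inner_hess hf hc, toCoord_ofCoord hc]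
  obtain ⟨m, hm, h₁⟩ := eventually_coercive hBc fun a ha => by
    rw [← hinner]; exact hpos _ (hof a ha)
  -- The strict bound by `κ` says that `B - κ G` is positive definite at the centre; its coercivity
  -- persists nearby.
  have hκc : ContinuousAt (fun u => B u - κ • gram c u) (extChartAt 𝓘(ℝ, E) c c) :=
    hBc.sub ((contDiffAt_gram hu).continuousAt.const_smul κ)
  obtain ⟨m', hm', h₂⟩ := eventually_coercive hκc fun a ha => by
    have h1 := hκ _ (hof a ha)
    rw [hinner, ← real_inner_self_eq_norm_sq, ← gram_toCoord hc, toCoord_ofCoord hc] at h1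
    simpa using h1
  have hbd : ∀ᶠ u in 𝓝 (extChartAt 𝓘(ℝ, E) c c), ‖B u‖ < ‖B (extChartAt 𝓘(ℝ, E) c c)‖ + 1 :=
    hBc.norm.eventually (gt_mem_nhds (lt_add_one _))
  obtain ⟨C₁, hC₁, h₃⟩ := exists_norm_toCoord_le (E := E) c
  obtain ⟨C₂, hC₂, h₄⟩ := exists_norm_ofCoord_le (E := E) c
  have hφ : Tendsto (extChartAt 𝓘(ℝ, E) c) (𝓝 c) (𝓝 (extChartAt 𝓘(ℝ, E) c c)) :=
    continuousAt_extChartAt c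
  refine ⟨m / C₂ ^ 2, by positivity, (‖B (extChartAt 𝓘(ℝ, E) c c)‖ + 1) * C₁ ^ 2, by positivity, ?_⟩
  filter_upwards [hφ.eventually h₁, hφ.eventually h₂, hφ.eventually hbd, h₃, h₄,
    (chartAt E c).open_source.mem_nhds hc] with y hy₁ hy₂ hyb hy₃ hy₄ hy v
  have hv : inner ℝ (hess E f y v) v = B (extChartAt 𝓘(ℝ, E) c y) (toCoord c y v)
      (toCoord c y v) := inner_hess hf hy v v
  refine ⟨?_, ?_, fun hv0 => ?_⟩
  · rw [hv]
    refine le_trans ?_ (hy₁ _)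
    have h := hy₄ (toCoord c y v)
    rw [ofCoord_toCoord hy] at h
    rw [div_mul_eq_mul_div, div_le_iff₀ (by positivity), mul_assoc, ← mul_pow, mul_comm _ C₂]
    gcongr
  · rw [hv]
    refine (le_abs_self _).trans (((B _).le_opNorm₂ _ _).trans ?_)
    calc ‖B (extChartAt 𝓘(ℝ, E) c y)‖ * ‖toCoord c y v‖ * ‖toCoord c y v‖
        ≤ (‖B (extChartAt 𝓘(ℝ, E) c c)‖ + 1) * (C₁ * ‖v‖) * (C₁ * ‖v‖) := by
          have := hy₃ v
          gcongr
      _ = _ := by ring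
  · have h1 := hy₂ (toCoord c y v)
    have h0 : toCoord c y v ≠ 0 := fun h => hv0 (by rw [← ofCoord_toCoord hy v, h, map_zero])
    have h2 : 0 < m' * ‖toCoord c y v‖ ^ 2 := by positivity
    have h3 := gram_toCoord hy v v
    rw [real_inner_self_eq_norm_sq] at h3
    have h4 : (B (extChartAt 𝓘(ℝ, E) c y) - κ • gram c (extChartAt 𝓘(ℝ, E) c y))
        (toCoord c y v) (toCoord c y v) = B (extChartAt 𝓘(ℝ, E) c y) (toCoord c y v)
          (toCoord c y v) - κ * ‖v‖ ^ 2 := by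
      rw [← h3]; rfl
    rw [hv]
    linarith

/-- The pullbacks have first order expansions at a critical point, uniformly in the base point. -/
theorem exists_fderiv_pullback_expansion (hR : IsRetraction R)
    (hf : ContMDiff 𝓘(ℝ, E) 𝓘(ℝ, ℝ) 2 f)
    (hcrit : fderiv ℝ (f ∘ (extChartAt 𝓘(ℝ, E) c).symm) (extChartAt 𝓘(ℝ, E) c c) = 0)
    {δ : ℝ} (hδ : 0 < δ) :
    ∃ ρ > 0, ∀ᶠ y in 𝓝 c, ∀ ξ : TangentSpace 𝓘(ℝ, E) y, ‖ξ‖ ≤ ρ →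
      ∀ w : TangentSpace 𝓘(ℝ, E) y,
        |fderiv ℝ (pullback R f y) ξ w - inner ℝ (grad E f y) w - inner ℝ (hess E f y ξ) w| ≤
          δ * ‖ξ‖ * ‖w‖ := by
  have hc := mem_chart_source E c
  have hu := mem_target_of_mem_source hc
  set F := f ∘ (extChartAt 𝓘(ℝ, E) c).symm with hF
  obtain ⟨C, hC, hT⟩ := exists_norm_toCoord_le (E := E) c
  obtain ⟨hs1, hs2⟩ := (eventually_mem_source_retraction hR c).self_of_nhds
  obtain ⟨ρ, hρ, h⟩ := eventually_toCoord ((partialSnd_comp_expansion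
    (contDiffAt_comp_extChartAt_symm hf hu) hcrit (contDiffAt_coordRetraction hR hs1 hs2)
    (coordRetraction_zero hR hu) (fderiv_coordRetraction hR c)
    -- Two errors share `δ`: the fibrewise expansion, and the replacement of the Hessian at the
    -- critical point by the one at `y`. The factor `C²` pays for the coordinates of `ξ` and `w`.
    (δ := δ / (2 * C ^ 2)) (by positivity)).and (fderiv_pullback_eq_partialSnd hR hf c))
  have hBc := continuousAt_coordHess_extChartAt hf c
  have hφ : Tendsto (extChartAt 𝓘(ℝ, E) c) (𝓝 c) (𝓝 (extChartAt 𝓘(ℝ, E) c c)) :=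
    continuousAt_extChartAt c
  have hB : ∀ᶠ u in 𝓝 (extChartAt 𝓘(ℝ, E) c c),
      ‖coordHess (gram c) F u - fderiv ℝ (fderiv ℝ F) (extChartAt 𝓘(ℝ, E) c c)‖ <
        δ / (2 * C ^ 2) := by
    have := tendsto_iff_norm_sub_tendsto_zero.1 hBc
    rw [coordHess_of_fderiv_eq_zero hcrit] at this
    exact this.eventually (gt_mem_nhds (by positivity))
  refine ⟨ρ, hρ, ?_⟩
  filter_upwards [h, hT, hφ.eventually hB, (chartAt E c).open_source.mem_nhds hc]
    with y hy hyT hyB hys ξ hξ w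
  obtain ⟨h1, h2⟩ := hy ξ hξ
  obtain ⟨-, h3⟩ := hy 0 (by rw [norm_zero]; exact hρ.le)
  simp only [] at h2 h3
  rw [extChartAt_symm_apply hys, ofCoord_toCoord hys] at h2
  rw [extChartAt_symm_apply hys, ofCoord_toCoord hys] at h3
  set D := fderiv ℝ (fderiv ℝ F) (extChartAt 𝓘(ℝ, E) c c) with hD
  set B := coordHess (gram c) F (extChartAt 𝓘(ℝ, E) c y) with hBdef
  have e1 : fderiv ℝ (pullback R f y) ξ w = partialSnd (F ∘ coordRetraction R c)
      (extChartAt 𝓘(ℝ, E) c y, toCoord c y ξ) (toCoord c y w) := by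
    rw [h2, ContinuousLinearMap.comp_apply, ofCoord_toCoord hys]
  have e2 : inner ℝ (grad E f y) w = partialSnd (F ∘ coordRetraction R c)
      (extChartAt 𝓘(ℝ, E) c y, 0) (toCoord c y w) := by
    rw [map_zero] at h3
    rw [h3, ContinuousLinearMap.comp_apply, ofCoord_toCoord hys, hR.fderiv_pullback_zero hf]
  have e3 : inner ℝ (hess E f y ξ) w = B (toCoord c y ξ) (toCoord c y w) := inner_hess hf hys ξ w
  rw [e1, e2, e3]
  set p := partialSnd (F ∘ coordRetraction R c) (extChartAt 𝓘(ℝ, E) c y, toCoord c y ξ)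
  set q := partialSnd (F ∘ coordRetraction R c) (extChartAt 𝓘(ℝ, E) c y, 0)
  have e4 : p (toCoord c y w) - q (toCoord c y w) - B (toCoord c y ξ) (toCoord c y w) =
      (p - q - D (toCoord c y ξ)) (toCoord c y w) -
        (B - D) (toCoord c y ξ) (toCoord c y w) := by
    simp only [sub_apply]; ring
  rw [e4]
  refine (abs_sub _ _).trans ?_
  have b1 : |(p - q - D (toCoord c y ξ)) (toCoord c y w)| ≤
      δ / (2 * C ^ 2) * (C * ‖ξ‖) * (C * ‖w‖) := by
    refine ((p - q - D (toCoord c y ξ)).le_opNorm _).trans ?_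
    have := hyT w
    have h5 : ‖p - q - D (toCoord c y ξ)‖ ≤ δ / (2 * C ^ 2) * (C * ‖ξ‖) :=
      h1.trans (by have := hyT ξ; gcongr)
    gcongr
  have b2 : |(B - D) (toCoord c y ξ) (toCoord c y w)| ≤
      δ / (2 * C ^ 2) * (C * ‖ξ‖) * (C * ‖w‖) := by
    refine ((B - D).le_opNorm₂ _ _).trans ?_
    have := hyT w
    have := hyT ξ
    gcongr
  refine (add_le_add b1 b2).trans (le_of_eq ?_)
  field_simp
  ring

theorem pos_fderiv_fderiv (hf : ContMDiff 𝓘(ℝ, E) 𝓘(ℝ, ℝ) 2 f)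
    (hcrit : fderiv ℝ (f ∘ (extChartAt 𝓘(ℝ, E) c).symm) (extChartAt 𝓘(ℝ, E) c c) = 0)
    (hpos : ∀ v : TangentSpace 𝓘(ℝ, E) c, v ≠ 0 → 0 < inner ℝ (hess E f c v) v) (a : E)
    (ha : a ≠ 0) : 0 < fderiv ℝ (fderiv ℝ (f ∘ (extChartAt 𝓘(ℝ, E) c).symm))
      (extChartAt 𝓘(ℝ, E) c c) a a := by
  have hc := mem_chart_source E c
  have h := hpos (ofCoord c c a) fun h => ha (by rw [← toCoord_ofCoord hc a, h, map_zero])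
  rwa [inner_hess hf hc, toCoord_ofCoord hc, coordHess_of_fderiv_eq_zero hcrit] at h

variable [IsRiemannianManifold 𝓘(ℝ, E) M]

/-- The distance to `c` is controlled by the chart distance, this by the derivative of `f` at the
new point (nondegeneracy), and this by the fibre derivative of `f ∘ R`. -/
theorem exists_edist_retraction_le (hR : IsRetraction R)
    (hf : ContMDiff 𝓘(ℝ, E) 𝓘(ℝ, ℝ) 2 f)
    (hcrit : fderiv ℝ (f ∘ (extChartAt 𝓘(ℝ, E) c).symm) (extChartAt 𝓘(ℝ, E) c c) = 0)
    (hpos : ∀ v : TangentSpace 𝓘(ℝ, E) c, v ≠ 0 → 0 < inner ℝ (hess E f c v) v) :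
    ∃ C > 0, ∃ ρ > 0, ∀ᶠ y in 𝓝 c, ∀ ξ : TangentSpace 𝓘(ℝ, E) y, ‖ξ‖ ≤ ρ →
      edist c (R y ξ) ≤ ENNReal.ofReal (C * ‖fderiv ℝ (pullback R f y) ξ‖) := by
  have hc := mem_chart_source E c
  have hu := mem_target_of_mem_source hc
  have hF := contDiffAt_comp_extChartAt_symm hf hu
  obtain ⟨C₁, hC₁, h₁⟩ := exists_norm_ofCoord_le (E := E) c
  obtain ⟨C₂, hC₂, h₂⟩ := exists_edist_le_norm_extChartAt (E := E) c
  obtain ⟨a, ha, _, _, h₃⟩ := norm_fderiv_comparable hF hcrit (pos_fderiv_fderiv hf hcrit hpos)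
  obtain ⟨hs1, hs2⟩ := (eventually_mem_source_retraction hR c).self_of_nhds
  have hRc := contDiffAt_coordRetraction hR hs1 hs2
  have hR0 := coordRetraction_zero hR hu
  have h₄ : ∀ᶠ p in 𝓝 ((extChartAt 𝓘(ℝ, E) c c, 0) : E × E),
      a * ‖coordRetraction R c p - extChartAt 𝓘(ℝ, E) c c‖ ≤
        ‖fderiv ℝ (f ∘ (extChartAt 𝓘(ℝ, E) c).symm) (coordRetraction R c p)‖ := by
    have := hRc.continuousAt.tendsto
    rw [hR0] at this
    exact this.eventually (h₃.mono fun _ h => h.1)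
  have h₅ : ∀ᶠ p in 𝓝 ((extChartAt 𝓘(ℝ, E) c c, 0) : E × E),
      edist c (R ((extChartAt 𝓘(ℝ, E) c).symm p.1)
        (ofCoord c ((extChartAt 𝓘(ℝ, E) c).symm p.1) p.2)) ≤
      ENNReal.ofReal (C₂ * ‖coordRetraction R c p - extChartAt 𝓘(ℝ, E) c c‖) := by
    have := (contMDiffAt_retraction hR hs1).continuousAt.tendsto
    simp only [map_zero, hR.map_zero] at this
    rw [extChartAt_symm_apply hc] at this
    exact this.eventually h₂
  obtain ⟨ρ, hρ, h⟩ := eventually_toCoord ((norm_fderiv_le_partialSnd hF hRc hR0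
    (fderiv_coordRetraction hR c)).and ((fderiv_pullback_eq_partialSnd hR hf c).and
      (h₄.and h₅)))
  refine ⟨C₂ * (2 * C₁ / a), by positivity, ρ, hρ, ?_⟩
  filter_upwards [h, h₁, (chartAt E c).open_source.mem_nhds hc] with y hy hy₁ hys ξ hξ
  obtain ⟨k1, k2, k3, k4⟩ := hy ξ hξ
  simp only [] at k2 k4
  rw [extChartAt_symm_apply hys, ofCoord_toCoord hys] at k2
  rw [extChartAt_symm_apply hys, ofCoord_toCoord hys] at k4
  refine k4.trans (ENNReal.ofReal_le_ofReal ?_)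
  rw [mul_assoc]
  gcongr
  have k5 : ‖partialSnd ((f ∘ (extChartAt 𝓘(ℝ, E) c).symm) ∘ coordRetraction R c)
      (extChartAt 𝓘(ℝ, E) c y, toCoord c y ξ)‖ ≤ C₁ * ‖fderiv ℝ (pullback R f y) ξ‖ := by
    rw [k2]
    refine ContinuousLinearMap.opNorm_le_bound _ (by positivity) fun w => ?_
    rw [ContinuousLinearMap.comp_apply]
    refine (ContinuousLinearMap.le_opNorm _ _).trans ?_
    calc ‖fderiv ℝ (pullback R f y) ξ‖ * ‖ofCoord c y w‖
        ≤ ‖fderiv ℝ (pullback R f y) ξ‖ * (C₁ * ‖w‖) := by gcongr; exact hy₁ w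
      _ = _ := by ring
  rw [div_mul_eq_mul_div, le_div_iff₀ ha, mul_comm _ a]
  linarith

theorem exists_norm_grad_le_edist
    (hf : ContMDiff 𝓘(ℝ, E) 𝓘(ℝ, ℝ) 2 f)
    (hcrit : fderiv ℝ (f ∘ (extChartAt 𝓘(ℝ, E) c).symm) (extChartAt 𝓘(ℝ, E) c c) = 0)
    (hpos : ∀ v : TangentSpace 𝓘(ℝ, E) c, v ≠ 0 → 0 < inner ℝ (hess E f c v) v) :
    ∃ C > 0, ∀ᶠ y in 𝓝 c,
      ENNReal.ofReal ‖grad E f y‖ ≤ ENNReal.ofReal C * edist c y := by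
  have hu := mem_target_of_mem_source (mem_chart_source E c)
  have hF := contDiffAt_comp_extChartAt_symm hf hu
  obtain ⟨C₁, hC₁, h₁⟩ := exists_norm_grad_comparable hf c
  obtain ⟨C₂, hC₂, h₂⟩ := exists_norm_extChartAt_le_edist (E := E) c
  obtain ⟨_, _, a, ha, h₃⟩ := norm_fderiv_comparable hF hcrit (pos_fderiv_fderiv hf hcrit hpos)
  have hφ : Tendsto (extChartAt 𝓘(ℝ, E) c) (𝓝 c) (𝓝 (extChartAt 𝓘(ℝ, E) c c)) :=
    continuousAt_extChartAt c
  refine ⟨C₁ * a * C₂, by positivity, ?_⟩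
  filter_upwards [h₁, h₂, hφ.eventually h₃] with y hy₁ hy₂ hy₃
  calc ENNReal.ofReal ‖grad E f y‖
      ≤ ENNReal.ofReal (C₁ * a * ‖extChartAt 𝓘(ℝ, E) c y - extChartAt 𝓘(ℝ, E) c c‖) := by
        refine ENNReal.ofReal_le_ofReal (hy₁.2.trans ?_)
        rw [mul_assoc]
        gcongr
        exact hy₃.2
    _ ≤ ENNReal.ofReal (C₁ * a) * (ENNReal.ofReal C₂ * edist c y) := by
        rw [ENNReal.ofReal_mul (by positivity)]
        gcongr
    _ = ENNReal.ofReal (C₁ * a * C₂) * edist c y := by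
        rw [← mul_assoc, ← ENNReal.ofReal_mul (by positivity)]

end Local

/-- The mean value inequality on `[0, 1]` for `m (s η)` minus its quadratic model in `s`. Only first
derivatives enter, which suits the uniform expansion of the pullbacks. -/
theorem abs_taylor_le {V : Type*} [NormedAddCommGroup V] [NormedSpace ℝ V] {m : V → ℝ}
    (hm : Differentiable ℝ m) {η : V} {A B K : ℝ}
    (h : ∀ s ∈ Icc (0 : ℝ) 1, |fderiv ℝ m (s • η) η - A - s * B| ≤ K) :
    |m η - m 0 - A - B / 2| ≤ K := by
  have hd : ∀ s : ℝ, HasDerivAt (fun s : ℝ => m (s • η) - s * A - s ^ 2 / 2 * B)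
      (fderiv ℝ m (s • η) η - A - s * B) s := by
    intro s
    have h1 : HasDerivAt (fun s : ℝ => s • η) η s := by
      simpa using (hasDerivAt_id s).smul_const η
    have h2 := (hm (s • η)).hasFDerivAt.comp_hasDerivAt s h1
    have h3 : HasDerivAt (fun s : ℝ => s * A) A s := by
      simpa using (hasDerivAt_id s).mul_const A
    have h4 : HasDerivAt (fun s : ℝ => s ^ 2 / 2 * B) (s * B) s := by
      have := (((hasDerivAt_id s).pow 2).div_const 2).mul_const B
      simpa using this
    exact (h2.sub h3).sub h4
  have := (convex_Icc (0 : ℝ) 1).norm_image_sub_le_of_norm_hasDerivWithin_le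
    (fun s _ => (hd s).hasDerivWithinAt) h (left_mem_Icc.2 zero_le_one)
    (right_mem_Icc.2 zero_le_one)
  simp only [one_smul, zero_smul, Real.norm_eq_abs, sub_zero, abs_one, mul_one] at this
  convert this using 2
  ring

/-! ### The iterates: descent, criticality of the limit, unit steps -/

section Sequence

variable {E : Type*} [NormedAddCommGroup E] [NormedSpace ℝ E] [FiniteDimensional ℝ E]
  {M : Type*} [EMetricSpace M] [ChartedSpace E M] [IsManifold 𝓘(ℝ, E) ∞ M]
  [RiemannianBundle (fun x : M => TangentSpace 𝓘(ℝ, E) x)]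
  {R : (x : M) → TangentSpace 𝓘(ℝ, E) x → M} {f : M → ℝ}
  {P : (x : M) → TangentSpace 𝓘(ℝ, E) x ≃ₗ[ℝ] TangentSpace 𝓘(ℝ, E) x}
  {χ₁ χ₂ ε p₁ p₂ : ℝ} {φ : ℕ → ℝ}
  {x : ℕ → M} {η : (k : ℕ) → TangentSpace 𝓘(ℝ, E) (x k)} {α : ℕ → ℝ} {c : M}

theorem acceptable_iff (hR : IsRetraction R) (hf : ContMDiff 𝓘(ℝ, E) 𝓘(ℝ, ℝ) 2 f) (y : M)
    (ξ : TangentSpace 𝓘(ℝ, E) y) (a : ℝ) : Acceptable R f χ₁ χ₂ y ξ a ↔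
      f (R y (a • ξ)) - f y ≤ -χ₁ * (inner ℝ (grad E f y) ξ ^ 2 / ‖ξ‖ ^ 2) ∨
      f (R y (a • ξ)) - f y ≤ χ₂ * inner ℝ (grad E f y) ξ := by
  simp only [Acceptable, (hR.hasDerivAt_pullback hf ξ).deriv, zero_smul, hR.map_zero]

/-- Either line search condition forces a decrease of at least `K ‖grad f‖²`, and consecutive values
of `f` along a convergent sequence have differences tending to `0`. -/
theorem IsTruncatedNewton.tendsto_norm_grad
    (hx : IsTruncatedNewton R f P χ₁ χ₂ ε φ x η α)
    (hR : IsRetraction R) (hf : ContMDiff 𝓘(ℝ, E) 𝓘(ℝ, ℝ) 2 f) (hχ₁ : 0 < χ₁) (hχ₂ : 0 < χ₂)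
    (hgrad : ∀ k, grad E f (x k) ≠ 0) (hlim : Tendsto x atTop (𝓝 c)) {a b : ℝ} (ha : 0 < a)
    (hb : 0 < b) (hdir : ∀ᶠ k in atTop,
      inner ℝ (grad E f (x k)) (η k) ≤ -a * ‖grad E f (x k)‖ ^ 2 ∧
      ‖η k‖ ≤ b * ‖grad E f (x k)‖) :
    Tendsto (fun k => ‖grad E f (x k)‖) atTop (𝓝 0) := by
  -- The two entries belong to the two line search conditions; `a / b` is the resulting bound for
  -- the slope divided by `‖η‖ ‖grad f‖`.
  set K := min (χ₁ * (a / b) ^ 2) (χ₂ * a) with hK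
  have hK0 : 0 < K := lt_min (by positivity) (by positivity)
  have hfx : Tendsto (fun k => f (x k)) atTop (𝓝 (f c)) :=
    (hf.continuous.tendsto c).comp hlim
  have hD : Tendsto (fun k => (f (x k) - f (x (k + 1))) / K) atTop (𝓝 0) := by
    have := (hfx.sub (hfx.comp (tendsto_add_atTop_nat 1))).div_const K
    simpa using this
  have hsq : Tendsto (fun k => ‖grad E f (x k)‖ ^ 2) atTop (𝓝 0) := by
    refine squeeze_zero' (Eventually.of_forall fun k => by positivity) ?_ hD
    filter_upwards [hdir] with k ⟨h1, h2⟩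
    have hg : 0 < ‖grad E f (x k)‖ := norm_pos_iff.2 (hgrad k)
    rw [le_div_iff₀ hK0]
    have hacc := (acceptable_iff hR hf _ _ _).1 (hx.acceptable k)
    rw [← hx.step k] at hacc
    set g := ‖grad E f (x k)‖
    have hη : 0 < ‖η k‖ := by
      rw [norm_pos_iff]
      intro h0
      rw [h0, inner_zero_right] at h1
      have : 0 < a * g ^ 2 := by positivity
      linarith
    rcases hacc with h | h
    · have h3 : a / b * g ≤ -inner ℝ (grad E f (x k)) (η k) / ‖η k‖ := by
        rw [le_div_iff₀ hη]
        calc a / b * g * ‖η k‖ ≤ a / b * g * (b * g) := by gcongr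
          _ = a * g ^ 2 := by field_simp
          _ ≤ _ := by linarith
      have h4 : (a / b) ^ 2 * g ^ 2 ≤ inner ℝ (grad E f (x k)) (η k) ^ 2 / ‖η k‖ ^ 2 := by
        rw [← mul_pow, ← neg_sq (inner ℝ (grad E f (x k)) (η k)), ← div_pow]
        gcongr
      have h5 := mul_le_mul_of_nonneg_left h4 hχ₁.le
      have h6 : g ^ 2 * K ≤ g ^ 2 * (χ₁ * (a / b) ^ 2) := by gcongr; exact min_le_left _ _
      linarith
    · have h5 := mul_le_mul_of_nonneg_left h1 hχ₂.le
      have h6 : g ^ 2 * K ≤ g ^ 2 * (χ₂ * a) := by gcongr; exact min_le_right _ _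
      linarith
  have := (Real.continuous_sqrt.tendsto 0).comp hsq
  simpa [Function.comp_def, Real.sqrt_sq] using this

theorem gradient_pullback_zero (hR : IsRetraction R) (hf : ContMDiff 𝓘(ℝ, E) 𝓘(ℝ, ℝ) 2 f)
    (y : M) : gradient (pullback R f y) 0 = grad E f y := by
  refine ext_inner_right ℝ fun w => ?_
  rw [gradient, InnerProductSpace.toDual_symm_apply, hR.fderiv_pullback_zero hf]

/-- On the ball of radius `‖ξ‖` the Hessian of the pullback stays within `β ‖ξ‖` of its value at
`0`, so the mean value inequality bounds the linearization error of the gradient by `β ‖ξ‖²`. -/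
theorem norm_fderiv_pullback_le_of_lipschitz (hR : IsRetraction R)
    (hf : ContMDiff 𝓘(ℝ, E) 𝓘(ℝ, ℝ) 2 f) {y : M} {ξ : TangentSpace 𝓘(ℝ, E) y} {β μ : ℝ}
    (hβ : 0 ≤ β) (hξ : ‖ξ‖ ≤ μ) (h : ∀ ζ : TangentSpace 𝓘(ℝ, E) y, ‖ζ‖ ≤ μ →
      ‖hessPullback R f y ζ - hessPullback R f y 0‖ ≤ β * ‖ζ‖) :
    ‖fderiv ℝ (pullback R f y) ξ‖ ≤
      ‖grad E f y + hessPullback R f y 0 ξ‖ + β * ‖ξ‖ ^ 2 := by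
  have hd : Differentiable ℝ (gradient (pullback R f y)) := by
    have h1 : ContDiff ℝ 1 (fderiv ℝ (pullback R f y)) :=
      (hR.contDiff_pullback hf y).fderiv_right (by norm_num)
    exact ((InnerProductSpace.toDual ℝ (TangentSpace 𝓘(ℝ, E) y)).symm.contDiff.comp
      h1).differentiable (by norm_num)
  have h1 := (convex_closedBall (0 : TangentSpace 𝓘(ℝ, E) y)
    ‖ξ‖).norm_image_sub_le_of_norm_fderiv_le' (f := gradient (pullback R f y)) (𝕜 := ℝ)
    (φ := hessPullback R f y 0) (C := β * ‖ξ‖) (x := 0) (y := ξ) (fun ζ _ => hd ζ)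
    (fun ζ hζ => by
      rw [mem_closedBall_zero_iff] at hζ
      exact (h ζ (hζ.trans hξ)).trans (by gcongr))
    (by simp) (by simp)
  rw [sub_zero, gradient_pullback_zero hR hf] at h1
  have h2 : ‖gradient (pullback R f y) ξ‖ = ‖fderiv ℝ (pullback R f y) ξ‖ :=
    (InnerProductSpace.toDual ℝ (TangentSpace 𝓘(ℝ, E) y)).symm.norm_map _
  rw [← h2]
  calc ‖gradient (pullback R f y) ξ‖
      = ‖(grad E f y + hessPullback R f y 0 ξ) +
          (gradient (pullback R f y) ξ - grad E f y - hessPullback R f y 0 ξ)‖ := by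
        congr 1; abel
    _ ≤ _ := (norm_add_le _ _).trans (by rw [sq, ← mul_assoc]; gcongr)

variable [IsContMDiffRiemannianBundle 𝓘(ℝ, E) ∞ E (fun x : M => TangentSpace 𝓘(ℝ, E) x)]

/-- The eigenvalue bounds are available only on the level set, so descent must be proved without
them: it needs only that no returned vector is an ascent direction. -/
theorem IsTruncatedNewton.le_initial (hx : IsTruncatedNewton R f P χ₁ χ₂ ε φ x η α)
    (hR : IsRetraction R) (hf : ContMDiff 𝓘(ℝ, E) 𝓘(ℝ, ℝ) 2 f) (hχ₁ : 0 < χ₁) (hχ₂ : 0 < χ₂)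
    (hε : 0 < ε) (hP : IsPreconditioner P f (x 0) p₁ p₂) (hφ : ∀ k, 0 ≤ φ k)
    (hgrad : ∀ k, grad E f (x k) ≠ 0) (k : ℕ) : f (x k) ≤ f (x 0) := by
  induction k with
  | zero => exact le_rfl
  | succ k ih =>
    refine le_trans ?_ ih
    obtain ⟨H, hH⟩ := exists_linearMap_eq_hess hf (x k)
    have hdir := hx.direction k
    rw [← hH] at hdir
    have hle := hdir.inner_nonpos (by rw [hH]; exact hess_symm hf (x k)) (hP.symm _) (hP.pos _)
      hε.le (hφ k) (hgrad k)
    have hacc := (acceptable_iff hR hf _ _ _).1 (hx.acceptable k)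
    rw [← hx.step k] at hacc
    have h1 : 0 ≤ χ₁ * (inner ℝ (grad E f (x k)) (η k) ^ 2 / ‖η k‖ ^ 2) := by positivity
    have h2 := mul_nonneg hχ₂.le (neg_nonneg.2 hle)
    rcases hacc with h | h <;> linarith

/-- Near a nondegenerate minimizer the search directions are inexact Newton directions of size
comparable to the gradient. -/
theorem IsTruncatedNewton.eventually_direction
    (hx : IsTruncatedNewton R f P χ₁ χ₂ ε φ x η α)
    (hR : IsRetraction R) (hf : ContMDiff 𝓘(ℝ, E) 𝓘(ℝ, ℝ) 2 f) (hχ₁ : 0 < χ₁) (hχ₂ : 0 < χ₂)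
    (hε : 0 < ε) (hp₁ : 0 < p₁) (hP : IsPreconditioner P f (x 0) p₁ p₂)
    (hφ : ∀ k, 0 ≤ φ k) (hφ' : ∀ k, φ k ≤ 1)
    (hgrad : ∀ k, grad E f (x k) ≠ 0) (hlim : Tendsto x atTop (𝓝 c))
    (hpos : ∀ v : TangentSpace 𝓘(ℝ, E) c, v ≠ 0 → 0 < inner ℝ (hess E f c v) v)
    (hκ : ∀ v : TangentSpace 𝓘(ℝ, E) c, v ≠ 0 →
      ε * (p₂ / p₁) * ‖v‖ ^ 2 < inner ℝ (hess E f c v) v) :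
    ∃ a > 0, ∃ b > 0, ∀ᶠ k in atTop,
      ‖hess E f (x k) (η k) + grad E f (x k)‖ ≤ φ k * ‖grad E f (x k)‖ ∧
      inner ℝ (grad E f (x k)) (η k) ≤ -a * ‖grad E f (x k)‖ ^ 2 ∧
      ‖η k‖ ≤ b * ‖grad E f (x k)‖ := by
  obtain ⟨m, hm, Λ, hΛ, hb⟩ := exists_hess_bounds hf hpos hκ
  have hPb : ∀ k, _ := fun k => inner_bounds_of_eigenvalue_mem (P (x k)).toLinearMap
    (hP.symm (x k)) hp₁ (hP.eigenvalue_mem (x k) (hx.le_initial hR hf hχ₁ hχ₂ hε hP hφ hgrad k))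
  have hp₂ : 0 < p₂ := by
    have h0 : 0 < ‖grad E f (x 0)‖ ^ 2 := pow_pos (norm_pos_iff.2 (hgrad 0)) 2
    have h1 := hPb 0 (grad E f (x 0))
    exact hp₁.trans_le (le_of_mul_le_mul_right (h1.1.trans h1.2.1) h0)
  refine ⟨p₁ / (p₂ * Λ), by positivity, 2 / m, by positivity, ?_⟩
  filter_upwards [hlim.eventually hb] with k hk
  obtain ⟨H, hH⟩ := exists_linearMap_eq_hess hf (x k)
  have hdir := hx.direction k
  rw [← hH] at hdir hk
  obtain ⟨h1, h2⟩ := hdir.residual_and_slope (by rw [hH]; exact hess_symm hf (x k)) (hP.symm _)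
    (hP.pos _) hε.le (hφ k) (hgrad k) hp₁ hΛ (fun v => (hPb k v).1) (fun v => (hPb k v).2.1)
    (fun v => (hPb k v).2.2) (fun v hv => (hk v).2.2 hv) (fun v => (hk v).2.1)
  rw [← hH]
  refine ⟨h1, h2, ?_⟩
  set g := grad E f (x k)
  -- Since `φ ≤ 1`, the residual and the gradient each contribute at most `‖g‖ ‖η‖` to `⟪H η, η⟫`.
  have h3 : m * ‖η k‖ ^ 2 ≤ 2 * ‖g‖ * ‖η k‖ := by
    have e : inner ℝ (H (η k)) (η k) = inner ℝ (H (η k) + g) (η k) - (inner ℝ g (η k) : ℝ) := by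
      rw [inner_add_left]; ring
    have h4 : inner ℝ (H (η k) + g) (η k) ≤ ‖g‖ * ‖η k‖ := by
      refine (real_inner_le_norm _ _).trans ?_
      gcongr
      exact h1.trans (mul_le_of_le_one_left (norm_nonneg _) (hφ' k))
    have h5 := neg_le_of_abs_le (abs_real_inner_le_norm g (η k))
    linarith [(hk (η k)).1]
  rcases (norm_nonneg (η k)).eq_or_lt with h0 | h0
  · rw [← h0]; positivity
  · rw [div_mul_eq_mul_div, le_div_iff₀ hm, mul_comm]
    refine le_of_mul_le_mul_right ?_ h0
    linarith

theorem fderiv_eq_zero_of_tendsto_norm_grad (hf : ContMDiff 𝓘(ℝ, E) 𝓘(ℝ, ℝ) 2 f)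
    (hlim : Tendsto x atTop (𝓝 c)) (h : Tendsto (fun k => ‖grad E f (x k)‖) atTop (𝓝 0)) :
    fderiv ℝ (f ∘ (extChartAt 𝓘(ℝ, E) c).symm) (extChartAt 𝓘(ℝ, E) c c) = 0 := by
  obtain ⟨C, hC, hle⟩ := exists_norm_grad_comparable hf c
  have hcont : ContinuousAt (fderiv ℝ (f ∘ (extChartAt 𝓘(ℝ, E) c).symm))
      (extChartAt 𝓘(ℝ, E) c c) :=
    ((contDiffAt_comp_extChartAt_symm hf (mem_target_of_mem_source
      (mem_chart_source E c))).fderiv_right (m := 1) (by norm_num)).continuousAt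
  have h1 := (hcont.tendsto.comp (continuousAt_extChartAt (I := 𝓘(ℝ, E)) c)).comp hlim
  refine tendsto_nhds_unique h1 (squeeze_zero_norm' ?_ (by simpa using h.const_mul C))
  filter_upwards [hlim.eventually hle] with k hk
  exact hk.1

/-- For a nearly exact Newton direction `⟪H η, η⟫ ≈ -⟪g, η⟫`, so the quadratic model decreases by
about half the slope. The gap `½ - χ₂` absorbs the errors, which are small relative to `‖g‖²`. -/
theorem eventually_acceptable_one (hR : IsRetraction R) (hf : ContMDiff 𝓘(ℝ, E) 𝓘(ℝ, ℝ) 2 f)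
    (hχ₂ : χ₂ < 1 / 2) (hlim : Tendsto x atTop (𝓝 c))
    (hcrit : fderiv ℝ (f ∘ (extChartAt 𝓘(ℝ, E) c).symm) (extChartAt 𝓘(ℝ, E) c c) = 0)
    {a b : ℝ} (ha : 0 < a) (hb : 0 < b) (hdir : ∀ᶠ k in atTop,
      ‖hess E f (x k) (η k) + grad E f (x k)‖ ≤ φ k * ‖grad E f (x k)‖ ∧
      inner ℝ (grad E f (x k)) (η k) ≤ -a * ‖grad E f (x k)‖ ^ 2 ∧
      ‖η k‖ ≤ b * ‖grad E f (x k)‖)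
    (hg : Tendsto (fun k => ‖grad E f (x k)‖) atTop (𝓝 0)) (hφ : ∀ k, 0 ≤ φ k)
    (hφ0 : Tendsto φ atTop (𝓝 0)) :
    ∀ᶠ k in atTop, Acceptable R f χ₁ χ₂ (x k) (η k) 1 := by
  have hgap : 0 < (1 / 2 - χ₂) * a := mul_pos (by linarith) ha
  -- With this `δ` and `‖η‖ ≤ b ‖g‖`, the Taylor error takes half of `(½ - χ₂) a ‖g‖²`; half of the
  -- residual term takes the rest.
  obtain ⟨ρ, hρ, hexp⟩ := exists_fderiv_pullback_expansion hR hf hcrit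
    (δ := (1 / 2 - χ₂) * a / (2 * b ^ 2)) (by positivity)
  have hη : Tendsto (fun k => b * ‖grad E f (x k)‖) atTop (𝓝 0) := by
    simpa using hg.const_mul b
  have hφb : Tendsto (fun k => φ k * b) atTop (𝓝 0) := by simpa using hφ0.mul_const b
  filter_upwards [hdir, hlim.eventually hexp, hη.eventually (gt_mem_nhds hρ),
    hφb.eventually (gt_mem_nhds hgap)] with k ⟨h1, h2, h3⟩ hk hkρ hkφ
  rw [acceptable_iff hR hf]
  right
  rw [one_smul]
  obtain ⟨H, hH⟩ := exists_linearMap_eq_hess hf (x k)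
  rw [← hH] at h1 hk
  set g := grad E f (x k)
  set δ := (1 / 2 - χ₂) * a / (2 * b ^ 2) with hδ
  have hδ0 : 0 < δ := by positivity
  have hηk : ‖η k‖ ≤ ρ := h3.trans hkρ.le
  have htaylor := abs_taylor_le (m := pullback R f (x k)) (η := η k)
    (A := inner ℝ g (η k)) (B := inner ℝ (H (η k)) (η k)) (K := δ * ‖η k‖ * ‖η k‖)
    ((hR.contDiff_pullback hf (x k)).differentiable (by norm_num)) (fun s hs => by
      have hsη : ‖s • η k‖ ≤ ‖η k‖ := by
        rw [norm_smul, Real.norm_of_nonneg hs.1]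
        exact mul_le_of_le_one_left (norm_nonneg _) hs.2
      have := hk (s • η k) (hsη.trans hηk) (η k)
      rw [map_smul, real_inner_smul_left] at this
      exact this.trans (by gcongr))
  have h0 : pullback R f (x k) 0 = f (x k) := by rw [pullback, hR.map_zero]
  have e : inner ℝ (H (η k)) (η k) = inner ℝ (H (η k) + g) (η k) - (inner ℝ g (η k) : ℝ) := by
    rw [inner_add_left]; ring
  have h4 : inner ℝ (H (η k) + g) (η k) ≤ φ k * b * ‖g‖ ^ 2 := by
    refine (real_inner_le_norm _ _).trans ?_
    calc ‖H (η k) + g‖ * ‖η k‖ ≤ φ k * ‖g‖ * (b * ‖g‖) :=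
          mul_le_mul h1 h3 (norm_nonneg _) (mul_nonneg (hφ k) (norm_nonneg _))
      _ = _ := by ring
  have h5 : φ k * b * ‖g‖ ^ 2 ≤ (1 / 2 - χ₂) * a * ‖g‖ ^ 2 := by gcongr
  have h6 : δ * ‖η k‖ * ‖η k‖ ≤ (1 / 2 - χ₂) * a / 2 * ‖g‖ ^ 2 := by
    calc δ * ‖η k‖ * ‖η k‖ ≤ δ * (b * ‖g‖) * (b * ‖g‖) := by gcongr
      _ = _ := by rw [hδ]; field_simp
  have h7 : (1 / 2 - χ₂) * inner ℝ g (η k) ≤ (1 / 2 - χ₂) * (-a * ‖g‖ ^ 2) :=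
    mul_le_mul_of_nonneg_left h2 (by linarith)
  have h8 := (abs_le.1 htaylor).2
  rw [h0, e] at h8
  change pullback R f (x k) (η k) - f (x k) ≤ _
  linarith

/-- The linear part of the expansion at `η` is the Newton residual, at most `φ ‖g‖` with `φ → 0`;
the remainder is `o(‖η‖) = o(‖g‖)`. -/
theorem eventually_norm_fderiv_pullback_le (hR : IsRetraction R)
    (hf : ContMDiff 𝓘(ℝ, E) 𝓘(ℝ, ℝ) 2 f) (hlim : Tendsto x atTop (𝓝 c))
    (hcrit : fderiv ℝ (f ∘ (extChartAt 𝓘(ℝ, E) c).symm) (extChartAt 𝓘(ℝ, E) c c) = 0)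
    {b : ℝ} (hb : 0 < b) (hdir : ∀ᶠ k in atTop,
      ‖hess E f (x k) (η k) + grad E f (x k)‖ ≤ φ k * ‖grad E f (x k)‖ ∧
      ‖η k‖ ≤ b * ‖grad E f (x k)‖)
    (hg : Tendsto (fun k => ‖grad E f (x k)‖) atTop (𝓝 0))
    (hφ0 : Tendsto φ atTop (𝓝 0)) {δ : ℝ} (hδ : 0 < δ) :
    ∀ᶠ k in atTop, ‖fderiv ℝ (pullback R f (x k)) (η k)‖ ≤ δ * ‖grad E f (x k)‖ := by
  obtain ⟨ρ, hρ, hexp⟩ := exists_fderiv_pullback_expansion hR hf hcrit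
    (δ := δ / (2 * b)) (by positivity)
  have hη : Tendsto (fun k => b * ‖grad E f (x k)‖) atTop (𝓝 0) := by
    simpa using hg.const_mul b
  filter_upwards [hdir, hlim.eventually hexp, hη.eventually (gt_mem_nhds hρ),
    hφ0.eventually (gt_mem_nhds (half_pos hδ))] with k ⟨h1, h3⟩ hk hkρ hkφ
  refine ContinuousLinearMap.opNorm_le_bound _ (by positivity) fun w => ?_
  have h4 := hk (η k) (h3.trans hkρ.le) w
  set g := grad E f (x k)
  have h5 : |(inner ℝ (hess E f (x k) (η k) + g) w : ℝ)| ≤ δ / 2 * ‖g‖ * ‖w‖ := by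
    refine (abs_real_inner_le_norm _ _).trans ?_
    gcongr
    exact h1.trans (by gcongr)
  have h6 : δ / (2 * b) * ‖η k‖ * ‖w‖ ≤ δ / 2 * ‖g‖ * ‖w‖ := by
    refine mul_le_mul_of_nonneg_right ?_ (norm_nonneg _)
    calc δ / (2 * b) * ‖η k‖ ≤ δ / (2 * b) * (b * ‖g‖) := by gcongr
      _ = _ := by field_simp
  rw [inner_add_left] at h5
  rw [Real.norm_eq_abs]
  rw [abs_le] at *
  constructor <;> linarith

end Sequence

/-! ### Quotients of extended distances -/

theorem tendsto_div_of_forall_le {d : ℕ → ℝ≥0∞} {g : ℕ → ℝ} {C : ℝ} (hC : 0 < C)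
    (h : ∀ δ > 0, ∀ᶠ k in atTop, d (k + 1) ≤ ENNReal.ofReal (δ * g k))
    (hg : ∀ᶠ k in atTop, ENNReal.ofReal (g k) ≤ ENNReal.ofReal C * d k) :
    Tendsto (fun k => d (k + 1) / d k) atTop (𝓝 0) := by
  rw [ENNReal.tendsto_nhds_zero]
  intro ε hε
  obtain ⟨r, hr, hrε⟩ := ENNReal.lt_iff_exists_nnreal_btwn.1 hε
  have hr0 : (0 : ℝ) < r := by exact_mod_cast hr
  filter_upwards [h (r / C) (by positivity), hg] with k hk hgk
  -- The multiplicative bound suffices even if `d k` is `0` or `⊤`, so neither case has to be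
  -- excluded.
  refine le_trans (ENNReal.div_le_of_le_mul ?_) hrε.le
  calc d (k + 1) ≤ ENNReal.ofReal (r / C) * ENNReal.ofReal (g k) := by
        rwa [← ENNReal.ofReal_mul (by positivity)]
    _ ≤ ENNReal.ofReal (r / C) * (ENNReal.ofReal C * d k) := by gcongr
    _ = r * d k := by
        rw [← mul_assoc, ← ENNReal.ofReal_mul (by positivity), div_mul_cancel₀ _ hC.ne',
          ENNReal.ofReal_coe_nnreal]

theorem limsup_div_rpow_lt_top {d : ℕ → ℝ≥0∞} {g : ℕ → ℝ} {C K s : ℝ} (hs : 0 ≤ s) (hK : 0 ≤ K)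
    (hg0 : ∀ k, 0 ≤ g k) (h : ∀ᶠ k in atTop, d (k + 1) ≤ ENNReal.ofReal (K * g k ^ s))
    (hg : ∀ᶠ k in atTop, ENNReal.ofReal (g k) ≤ ENNReal.ofReal C * d k) :
    limsup (fun k => d (k + 1) / d k ^ s) atTop < ⊤ := by
  have hfin : ENNReal.ofReal K * ENNReal.ofReal C ^ s < ⊤ :=
    ENNReal.mul_lt_top ENNReal.ofReal_lt_top
      (ENNReal.rpow_lt_top_of_nonneg hs ENNReal.ofReal_ne_top)
  refine lt_of_le_of_lt (limsup_le_of_le (by isBoundedDefault) ?_) hfin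
  filter_upwards [h, hg] with k hk hgk
  refine ENNReal.div_le_of_le_mul ?_
  calc d (k + 1) ≤ ENNReal.ofReal K * ENNReal.ofReal (g k) ^ s := by
        rwa [ENNReal.ofReal_rpow_of_nonneg (hg0 k) hs, ← ENNReal.ofReal_mul hK]
    _ ≤ ENNReal.ofReal K * (ENNReal.ofReal C * d k) ^ s := by gcongr
    _ = ENNReal.ofReal K * ENNReal.ofReal C ^ s * d k ^ s := by
        rw [ENNReal.mul_rpow_of_nonneg _ _ hs, mul_assoc]

end RTN

end

/-! ### The convergence theorem -/

theorem theorem4p3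
    {E : Type*} [NormedAddCommGroup E] [NormedSpace ℝ E] [FiniteDimensional ℝ E]
    {M : Type*} [EMetricSpace M] [ChartedSpace E M] [IsManifold 𝓘(ℝ, E) ∞ M]
    [RiemannianBundle (fun x : M => TangentSpace 𝓘(ℝ, E) x)]
    [IsContMDiffRiemannianBundle 𝓘(ℝ, E) ∞ E (fun x : M => TangentSpace 𝓘(ℝ, E) x)]
    [IsRiemannianManifold 𝓘(ℝ, E) M]
    (f : M → ℝ) (hf : ContMDiff 𝓘(ℝ, E) 𝓘(ℝ, ℝ) 2 f)
    (R : (x : M) → TangentSpace 𝓘(ℝ, E) x → M) (hR : RTN.IsRetraction R)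
    (P : (x : M) → TangentSpace 𝓘(ℝ, E) x ≃ₗ[ℝ] TangentSpace 𝓘(ℝ, E) x)
    (χ₁ χ₂ ε β t p₁ p₂ : ℝ)
    (hχ₁ : 0 < χ₁) (hχ₂ : 0 < χ₂) (hχ₂' : χ₂ < 1 / 2) (hε : 0 < ε)
    (hβ : 0 < β) (hβ' : β ≤ 1) (ht : 0 < t) (ht' : t ≤ 1) (hp₁ : 0 < p₁)
    (x : ℕ → M) (η : (k : ℕ) → TangentSpace 𝓘(ℝ, E) (x k)) (α : ℕ → ℝ)
    (hP : RTN.IsPreconditioner P f (x 0) p₁ p₂)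
    (hgrad : ∀ k, RTN.grad E f (x k) ≠ 0)
    (hx : RTN.IsTruncatedNewton R f P χ₁ χ₂ ε
      (fun k => min β (‖RTN.grad E f (x k)‖ ^ t)) x η α)
    (xs : M) (hlim : Tendsto x atTop (𝓝 xs))
    (hpos : ∀ v : TangentSpace 𝓘(ℝ, E) xs, v ≠ 0 → 0 < inner ℝ (RTN.hess E f xs v) v)
    (hε' : ∀ v : TangentSpace 𝓘(ℝ, E) xs, v ≠ 0 →
      ε * (p₂ / p₁) * ‖v‖ ^ 2 < inner ℝ (RTN.hess E f xs v) v) :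
    (∀ᶠ k in atTop, RTN.Acceptable R f χ₁ χ₂ (x k) (η k) 1) ∧
    ((∀ᶠ k in atTop, RTN.Acceptable R f χ₁ χ₂ (x k) (η k) 1 → α k = 1) →
      Tendsto (fun k => edist xs (x (k + 1)) / edist xs (x k)) atTop (𝓝 0) ∧
      ((∃ β₁ : ℝ, 0 < β₁ ∧ ∀ k, ∀ v : TangentSpace 𝓘(ℝ, E) (x k),
          ‖RTN.hess E f (x k) v - RTN.hessPullback R f (x k) 0 v‖
            ≤ β₁ * ‖RTN.grad E f (x k)‖ * ‖v‖) →
        (∃ β₂ μ₁ μ₂ : ℝ, 0 < β₂ ∧ 0 < μ₁ ∧ 0 < μ₂ ∧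
          ∀ y : M, edist xs y ≤ ENNReal.ofReal μ₁ →
            ∀ ξ : TangentSpace 𝓘(ℝ, E) y, ‖ξ‖ ≤ μ₂ →
              ‖RTN.hessPullback R f y ξ - RTN.hessPullback R f y 0‖ ≤ β₂ * ‖ξ‖) →
        limsup (fun k => edist xs (x (k + 1)) / edist xs (x k) ^ (1 + min 1 t)) atTop < ⊤)) := by
  have hφ : ∀ k, 0 ≤ min β (‖RTN.grad E f (x k)‖ ^ t) := fun k => le_min hβ.le (by positivity)
  obtain ⟨a, ha, b, hb, hdir⟩ := hx.eventually_direction hR hf hχ₁ hχ₂ hε hp₁ hP hφ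
    (fun k => (min_le_left _ _).trans hβ') hgrad hlim hpos hε'
  have hg := hx.tendsto_norm_grad hR hf hχ₁ hχ₂ hgrad hlim ha hb (hdir.mono fun k h => h.2)
  have hcrit := RTN.fderiv_eq_zero_of_tendsto_norm_grad hf hlim hg
  have hgt : Tendsto (fun k => ‖RTN.grad E f (x k)‖ ^ t) atTop (𝓝 0) := by
    have := hg.rpow_const (p := t) (Or.inr ht.le)
    rwa [Real.zero_rpow ht.ne'] at this
  have hφ0 : Tendsto (fun k => min β (‖RTN.grad E f (x k)‖ ^ t)) atTop (𝓝 0) :=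
    squeeze_zero hφ (fun k => min_le_right _ _) hgt
  have hone := RTN.eventually_acceptable_one (χ₁ := χ₁) hR hf hχ₂' hlim hcrit ha hb hdir hg hφ hφ0
  refine ⟨hone, fun hα => ?_⟩
  obtain ⟨C, hC, ρ, hρ, hdist⟩ := RTN.exists_edist_retraction_le hR hf hcrit hpos
  obtain ⟨C', hC', hgd⟩ := RTN.exists_norm_grad_le_edist hf hcrit hpos
  have hη : Tendsto (fun k => b * ‖RTN.grad E f (x k)‖) atTop (𝓝 0) := by
    simpa using hg.const_mul b
  have hnext : ∀ᶠ k in atTop, edist xs (x (k + 1)) ≤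
      ENNReal.ofReal (C * ‖fderiv ℝ (RTN.pullback R f (x k)) (η k)‖) := by
    filter_upwards [hone, hα, hlim.eventually hdist, hη.eventually (gt_mem_nhds hρ), hdir]
      with k h1 h2 h3 h4 h5
    rw [hx.step k, h2 h1, one_smul]
    exact h3 _ (h5.2.2.trans h4.le)
  refine ⟨RTN.tendsto_div_of_forall_le hC' (fun δ hδ => ?_) (hlim.eventually hgd), ?_⟩
  · filter_upwards [hnext, RTN.eventually_norm_fderiv_pullback_le hR hf hlim hcrit hb
      (hdir.mono fun k h => ⟨h.1, h.2.2⟩) hg hφ0 (δ := δ / C) (by positivity)] with k h1 h2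
    refine h1.trans (ENNReal.ofReal_le_ofReal ?_)
    calc C * ‖fderiv ℝ (RTN.pullback R f (x k)) (η k)‖
        ≤ C * (δ / C * ‖RTN.grad E f (x k)‖) := by gcongr
      _ = δ * ‖RTN.grad E f (x k)‖ := by field_simp
  · rintro ⟨β₁, hβ₁, hhess⟩ ⟨β₂, μ₁, μ₂, hβ₂, hμ₁, hμ₂, hlip⟩
    rw [min_eq_right ht']
    have hs : 0 ≤ 1 + t := by linarith
    -- The three summands come from the forcing term, the gap between the two Hessians, and the
    -- Lipschitz remainder.
    have hK : 0 ≤ C * (1 + β₁ * b + β₂ * b ^ 2) := by positivity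
    refine RTN.limsup_div_rpow_lt_top (d := fun k => edist xs (x k))
      (g := fun k => ‖RTN.grad E f (x k)‖) (C := C') hs hK (fun k => norm_nonneg _) ?_
      (hlim.eventually hgd)
    have hball : ∀ᶠ y in 𝓝 xs, edist xs y ≤ ENNReal.ofReal μ₁ := by
      filter_upwards [Metric.eball_mem_nhds xs (ENNReal.ofReal_pos.2 hμ₁)] with y hy
      rw [edist_comm]
      exact le_of_lt hy
    filter_upwards [hnext, hlim.eventually hball, hη.eventually (gt_mem_nhds hμ₂), hdir,
      hg.eventually (gt_mem_nhds one_pos)] with k h1 h2 h3 ⟨h4, _, h5⟩ h6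
    refine h1.trans (ENNReal.ofReal_le_ofReal ?_)
    rw [mul_assoc]
    gcongr
    have h7 := RTN.norm_fderiv_pullback_le_of_lipschitz hR hf hβ₂.le (h5.trans h3.le)
      (hlip (x k) h2)
    have h8 := hhess k (η k)
    have hg0 : 0 < ‖RTN.grad E f (x k)‖ := norm_pos_iff.2 (hgrad k)
    set v := RTN.grad E f (x k)
    have h9 : ‖v + RTN.hessPullback R f (x k) 0 (η k)‖ ≤ ‖v‖ ^ (1 + t) + β₁ * b * ‖v‖ ^ 2 := by
      calc ‖v + RTN.hessPullback R f (x k) 0 (η k)‖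
          = ‖(RTN.hess E f (x k) (η k) + v) -
            (RTN.hess E f (x k) (η k) - RTN.hessPullback R f (x k) 0 (η k))‖ := by
            congr 1; abel
        _ ≤ ‖v‖ ^ t * ‖v‖ + β₁ * ‖v‖ * (b * ‖v‖) := by
            refine (norm_sub_le _ _).trans (add_le_add (h4.trans ?_) (h8.trans ?_))
            · gcongr
              exact min_le_right _ _
            · gcongr
        _ = ‖v‖ ^ (1 + t) + β₁ * b * ‖v‖ ^ 2 := by
            rw [Real.rpow_add hg0, Real.rpow_one]; ring
    -- Quadratic errors are absorbed because `t ≤ 1` and eventually `‖v‖ < 1`.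
    have h10 : ‖v‖ ^ 2 ≤ ‖v‖ ^ (1 + t) := by
      rw [← Real.rpow_two]
      exact Real.rpow_le_rpow_of_exponent_ge hg0 h6.le (by linarith)
    calc ‖fderiv ℝ (RTN.pullback R f (x k)) (η k)‖
        ≤ ‖v‖ ^ (1 + t) + β₁ * b * ‖v‖ ^ 2 + β₂ * (b * ‖v‖) ^ 2 :=
          h7.trans (add_le_add h9 (by gcongr))
      _ = ‖v‖ ^ (1 + t) + (β₁ * b + β₂ * b ^ 2) * ‖v‖ ^ 2 := by ring
      _ ≤ ‖v‖ ^ (1 + t) + (β₁ * b + β₂ * b ^ 2) * ‖v‖ ^ (1 + t) := by gcongr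
      _ = (1 + β₁ * b + β₂ * b ^ 2) * ‖v‖ ^ (1 + t) := by ring
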